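/- Let $T$ be the $d$-regular rooted tree whose vertices are the finite words over $X=\{1,\dots,d\}$, ordered by the prefix relation, and let $\mathrm{Aut}(T)$ be its automorphism group. For $g\in\mathrm{Aut}(T)$ and a vertex $v$, the state $g|_v\in\mathrm{Aut}(T)$ is the automorphism determined by $g(vw)=g(v)\,g|_v(w)$ for all words $w$. An automorphism $g$ is *finite-state* if $\{g|_v : v\in X^*\}$ is finite, and *bounded* if it is finite-state and the sequence $\theta_k(g)=|\{v\in X^k : g|_v \text{ acts non-trivially on } X\}|$, $k\ge 0$, is bounded. A finite-state automorphism is given to an algorithm by a finite invertible input-output automaton over $X$ with an initial state that defines it. Then: (1) The order problem for bounded automorphisms is decidable: there is an algorithm that, given a bounded automorphism $a$ of $T$, computes the order of $a$ in $\{1,2,\dots\}\cup\{\infty\}$. (2) The conjugacy problem and the simultaneous conjugacy problem for bounded automorphisms in $\mathrm{Aut}(T)$ are decidable: there is an algorithm that, given bounded automorphisms $a,b$ of $T$, decides whether there is $h\in\mathrm{Aut}(T)$ with $h^{-1}ah=b$; and there is an algorithm that, given $k\ge 0$ and bounded automorphisms $a_1,\dots,a_k,b_1,\dots,b_k$ of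 $T$, decides whether there is $h\in\mathrm{Aut}(T)$ with $h^{-1}a_ih=b_i$ for all $i$. The algorithms are uniform in $d$, which is part of the input. -/

import Mathlib

/-- The automorphism group `Aut(T)` of the regular rooted tree `T` over the alphabet
`X = Fin d`: the vertices are the finite words over `X`, and an automorphism is a bijection
of the vertex set that preserves the prefix order in both directions. -/
abbrev TreeAut (d : ℕ) : Type :=
  (fun u v : List (Fin d) => u <+: v) ≃r (fun u v : List (Fin d) => u <+: v)

namespace TreeAut

variable {d : ℕ}

theorem prefix_iff (g : TreeAut d) {u v : List (Fin d)} : g u <+: g v ↔ u <+: v :=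
  g.map_rel_iff

theorem nodup_inits (l : List (Fin d)) : l.inits.Nodup := by
  induction l with
  | nil => simp
  | cons a l ih =>
    rw [List.inits_cons, List.nodup_cons]
    exact ⟨by simp, ih.map (List.cons_injective)⟩

theorem length_le (g : TreeAut d) (v : List (Fin d)) : (g v).length ≤ v.length := by
  have h1 : ((g v).inits.toFinset).card = (g v).length + 1 := by
    rw [List.toFinset_card_of_nodup (nodup_inits _), List.length_inits]
  have h2 : (v.inits.toFinset).card = v.length + 1 := by
    rw [List.toFinset_card_of_nodup (nodup_inits _), List.length_inits]
  have h3 : (g v).inits.toFinset ⊆ v.inits.toFinset.image g := by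
    intro u hu
    rw [List.mem_toFinset, List.mem_inits] at hu
    refine Finset.mem_image.2 ⟨g.symm u, ?_, g.apply_symm_apply u⟩
    rw [List.mem_toFinset, List.mem_inits, ← g.prefix_iff, g.apply_symm_apply]
    exact hu
  have h4 := (Finset.card_le_card h3).trans Finset.card_image_le
  omega

/-- Tree automorphisms preserve the levels of the tree. -/
theorem length_apply (g : TreeAut d) (v : List (Fin d)) : (g v).length = v.length := by
  refine le_antisymm (g.length_le v) ?_
  have h := length_le g.symm (g v)
  rwa [g.symm_apply_apply] at h

theorem apply_append (g : TreeAut d) (v w : List (Fin d)) :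
    g (v ++ w) = g v ++ (g (v ++ w)).drop v.length := by
  obtain ⟨t, ht⟩ := g.prefix_iff.2 (List.prefix_append v w)
  rw [← ht, ← g.length_apply v, List.drop_left]

/-- The state `g|_v` of `g` at the vertex `v`: the automorphism determined by
`g (v w) = g(v) (g|_v)(w)` for all words `w`. -/
def state (g : TreeAut d) (v : List (Fin d)) : TreeAut d where
  toFun w := (g (v ++ w)).drop v.length
  invFun w := (g.symm (g v ++ w)).drop v.length
  left_inv w := by
    change (g.symm (g v ++ (g (v ++ w)).drop v.length)).drop v.length = w
    rw [← apply_append, g.symm_apply_apply, List.drop_left]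
  right_inv w := by
    change (g (v ++ (g.symm (g v ++ w)).drop v.length)).drop v.length = w
    have h := apply_append g.symm (g v) w
    rw [g.symm_apply_apply, g.length_apply] at h
    rw [← h, g.apply_symm_apply, ← g.length_apply v, List.drop_left]
  map_rel_iff' := by
    intro u w
    change (g (v ++ u)).drop v.length <+: (g (v ++ w)).drop v.length ↔ u <+: w
    rw [← List.prefix_append_right_inj (g v), ← apply_append, ← apply_append, g.prefix_iff,
      List.prefix_append_right_inj]

/-- The defining property of the states. -/
theorem apply_append_eq_state (g : TreeAut d) (v w : List (Fin d)) :
    g (v ++ w) = g v ++ g.state v w :=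
  g.apply_append v w

/-- `g` is finite-state: the set of its states is finite. -/
def IsFiniteState (g : TreeAut d) : Prop :=
  (Set.range g.state).Finite

/-- The activity `θ_k(g)`: the number of words `v` of length `k` such that the state `g|_v`
acts non-trivially on `X`, the first level of the tree. -/
noncomputable def activity (g : TreeAut d) (k : ℕ) : ℕ :=
  {v : List (Fin d) | v.length = k ∧ ∃ x : Fin d, g.state v [x] ≠ [x]}.ncard

/-- `g` is a bounded automorphism: it is finite-state and its activity is a bounded sequence. -/
def IsBounded (g : TreeAut d) : Prop :=
  g.IsFiniteState ∧ ∃ C : ℕ, ∀ k : ℕ, g.activity k ≤ C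

end TreeAut

/-- A finite invertible input-output automaton over the alphabet `Fin d` with a chosen initial
state. In the state `q`, on reading the letter `x`, the automaton outputs the letter `out q x`
and passes to the state `next q x`. -/
structure InitAutomaton (d : ℕ) where
  size : ℕ
  out : Fin size → Equiv.Perm (Fin d)
  next : Fin size → Fin d → Fin size
  init : Fin size

namespace InitAutomaton

variable {d : ℕ}

/-- The output word of the automaton, started in the state `q`, on a given input word. -/
def run (A : InitAutomaton d) : Fin A.size → List (Fin d) → List (Fin d)
  | _, [] => []
  | q, x :: w => A.out q x :: A.run (A.next q x) w

/-- The input word that produces a given output word, when started in the state `q`. -/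
def runInv (A : InitAutomaton d) : Fin A.size → List (Fin d) → List (Fin d)
  | _, [] => []
  | q, y :: w => (A.out q).symm y :: A.runInv (A.next q ((A.out q).symm y)) w

theorem runInv_run (A : InitAutomaton d) (q : Fin A.size) (w : List (Fin d)) :
    A.runInv q (A.run q w) = w := by
  induction w generalizing q with
  | nil => rfl
  | cons x w ih => simp [run, runInv, ih]

theorem run_runInv (A : InitAutomaton d) (q : Fin A.size) (w : List (Fin d)) :
    A.run q (A.runInv q w) = w := by
  induction w generalizing q with
  | nil => rfl
  | cons x w ih => simp [run, runInv, ih]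

theorem run_prefix_iff (A : InitAutomaton d) (q : Fin A.size) (u v : List (Fin d)) :
    A.run q u <+: A.run q v ↔ u <+: v := by
  induction u generalizing q v with
  | nil => simp [run]
  | cons x u ih =>
    cases v with
    | nil => simp [run]
    | cons y v =>
      simp only [run, List.cons_prefix_cons, EmbeddingLike.apply_eq_iff_eq]
      constructor
      · rintro ⟨rfl, h⟩
        exact ⟨rfl, (ih _ _).1 h⟩
      · rintro ⟨rfl, h⟩
        exact ⟨rfl, (ih _ _).2 h⟩

/-- The tree automorphism defined by the automaton started in its initial state. -/
def toAut (A : InitAutomaton d) : TreeAut d where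
  toFun := A.run A.init
  invFun := A.runInv A.init
  left_inv := A.runInv_run A.init
  right_inv := A.run_runInv A.init
  map_rel_iff' := by
    intro u v
    exact A.run_prefix_iff A.init u v

/-- The description of an automaton that is handed to an algorithm: the initial state, and the
table whose entry in row `q` and column `x` is the pair (output letter, next state). -/
def code (A : InitAutomaton d) : ℕ × List (List (ℕ × ℕ)) :=
  ((A.init : ℕ),
    List.ofFn fun q => List.ofFn fun x => ((A.out q x : ℕ), (A.next q x : ℕ)))

end InitAutomaton

/-! ### States of products, concatenations and fixed vertices -/

namespace TreeAut

variable {d : ℕ}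

/-! Let `H` be the subgroup of `Aut(T) × Aut(T)` generated by the pairs `(a_i, b_i)`. Its descendant
at a pair of vertices `(u, v)` consists of the pairs of states there of the elements of `H` fixing
both. A pair is matched if the two components of every element of `H` fix `u` and `v`
simultaneously; only such pairs can correspond under a conjugator.

The key is that a group generated by bounded automorphisms has finitely many matched descendants,
with an explicit bound `K` (`matchedDescendants_finite_and_ncard_le`). Boundedness limits the number
of non-trivial states on a level, so the orbital graph of a matched pair has at most `N` edges with
non-trivial label, uniformly in the level. Trivial labels do not lengthen products of states, so a
Schreier argument (`cocycleStab_eq_closure`) generates each descendant by products of at most `2 * N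
+ 1` factors from one finite set. For effectiveness, `IsBounded.ncard_state_ne_one_le` bounds the
non-trivial states on a level in terms of `d` and the number of states alone.

Conjugacy on the ball of radius `n + 1` amounts to an equivariant injection of letters together with
conjugacy on radius `n` for the resulting matched descendants. The sets of matched descendants
conjugate on radius `n` therefore decrease with `n`, and once two consecutive ones agree they stay
constant, which happens by radius `K`. Compactness turns conjugacy on all balls into conjugacy in
`Aut(T)`, so a finite search on radius `K` decides the problem.

For the order of `a`, the same bound is applied to the diagonal group generated by `(a, a)`. If `a`
has finite order, orbit lengths along a path grow only when a new descendant appears, hence at most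
`K` times (`period_le`). This bounds the finite orders, and each power is tested for triviality on a
ball whose radius bounds its number of states. -/

theorem mul_apply (g h : TreeAut d) (v : List (Fin d)) : (g * h) v = g (h v) := rfl

@[simp] theorem one_apply (v : List (Fin d)) : (1 : TreeAut d) v = v := rfl

@[simp] theorem apply_nil (g : TreeAut d) : g [] = [] :=
  List.eq_nil_of_length_eq_zero (g.length_apply [])

theorem eq_of_append_eq (g k : TreeAut d) (v : List (Fin d))
    (h : ∀ w, g (v ++ w) = g v ++ k w) : g.state v = k := by
  ext1 w
  exact List.append_cancel_left ((g.apply_append_eq_state v w).symm.trans (h w))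

theorem state_mul (g h : TreeAut d) (v : List (Fin d)) :
    (g * h).state v = g.state (h v) * h.state v := by
  apply eq_of_append_eq
  intro w
  rw [mul_apply, apply_append_eq_state, apply_append_eq_state, mul_apply, mul_apply]

@[simp] theorem state_one (v : List (Fin d)) : (1 : TreeAut d).state v = 1 :=
  eq_of_append_eq _ _ _ fun _ => rfl

@[simp] theorem state_nil (g : TreeAut d) : g.state [] = g :=
  eq_of_append_eq _ _ _ fun _ => by simp

theorem state_append (g : TreeAut d) (v w : List (Fin d)) :
    g.state (v ++ w) = (g.state v).state w := by
  apply eq_of_append_eq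
  intro u
  rw [List.append_assoc, apply_append_eq_state, apply_append_eq_state, apply_append_eq_state,
    List.append_assoc]

theorem apply_cons (g : TreeAut d) (x : Fin d) (w : List (Fin d)) :
    g (x :: w) = g [x] ++ g.state [x] w :=
  g.apply_append_eq_state [x] w

theorem append_fixed_iff (g : TreeAut d) (v w : List (Fin d)) :
    g (v ++ w) = v ++ w ↔ g v = v ∧ g.state v w = w := by
  rw [apply_append_eq_state]
  constructor
  · intro h
    exact List.append_inj h (g.length_apply v)
  · rintro ⟨h1, h2⟩
    rw [h1, h2]

theorem exists_apply_singleton (g : TreeAut d) (x : Fin d) : ∃ y, g [x] = [y] :=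
  List.length_eq_one_iff.1 (g.length_apply [x])

end TreeAut

/-! ### Schreier generation for cocycles with few non-trivial labels -/

section Cocycle

variable {Γ Ω M : Type*} [Group Γ] [MulAction Γ Ω] [Group M]

open scoped Pointwise

/-- The points of the orbit of `w₀` that are reached by an element of `H` on which the cocycle
`σ` takes a value in the `n`-th power of `U`. -/
def cocycleBall (σ : Γ → Ω → M) (H : Subgroup Γ) (U : Set M) (w₀ : Ω) (n : ℕ) : Set Ω :=
  {w | ∃ t ∈ H, t • w₀ = w ∧ σ t w₀ ∈ U ^ n}

/-- The values of a cocycle on the stabilizer in `H` of the point `w₀`. -/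
def cocycleStab (σ : Γ → Ω → M) (hσ : ∀ g h w, σ (g * h) w = σ g (h • w) * σ h w)
    (H : Subgroup Γ) (w₀ : Ω) : Subgroup M where
  carrier := {g | ∃ h ∈ H, h • w₀ = w₀ ∧ σ h w₀ = g}
  one_mem' := by
    refine ⟨1, H.one_mem, one_smul _ _, ?_⟩
    have h := hσ 1 1 w₀
    rw [one_smul, mul_one] at h
    exact left_eq_mul.1 h
  mul_mem' := by
    rintro _ _ ⟨g, hg, hgw, rfl⟩ ⟨h, hh, hhw, rfl⟩
    exact ⟨g * h, H.mul_mem hg hh, by rw [mul_smul, hhw, hgw], by rw [hσ, hhw]⟩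
  inv_mem' := by
    rintro _ ⟨g, hg, hgw, rfl⟩
    have h1 : σ 1 w₀ = 1 := by
      have h := hσ 1 1 w₀
      rw [one_smul, mul_one] at h
      exact left_eq_mul.1 h
    have hgi : g⁻¹ • w₀ = w₀ := by rw [inv_smul_eq_iff, hgw]
    refine ⟨g⁻¹, H.inv_mem hg, hgi, ?_⟩
    have h := hσ g g⁻¹ w₀
    rw [mul_inv_cancel, h1, hgi] at h
    exact (inv_eq_of_mul_eq_one_right h.symm).symm

theorem cocycleBall_subset_succ (σ : Γ → Ω → M) {H : Subgroup Γ} {U : Set M} (hU1 : 1 ∈ U) (w₀ : Ω) (n : ℕ) :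
    cocycleBall σ H U w₀ n ⊆ cocycleBall σ H U w₀ (n + 1) := by
  rintro _ ⟨t, ht, rfl, htU⟩
  exact ⟨t, ht, rfl, Set.pow_subset_pow_right hU1 n.le_succ htU⟩

variable {σ : Γ → Ω → M}

theorem mem_cocycleStab (hσ : ∀ g h w, σ (g * h) w = σ g (h • w) * σ h w)
    {H : Subgroup Γ} {w₀ : Ω} {g : M} :
    g ∈ cocycleStab σ hσ H w₀ ↔ ∃ h ∈ H, h • w₀ = w₀ ∧ σ h w₀ = g := Iff.rfl

theorem cocycle_one (hσ : ∀ g h w, σ (g * h) w = σ g (h • w) * σ h w)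
    (w : Ω) : σ 1 w = 1 := by
  have h := hσ 1 1 w
  rw [one_smul, mul_one] at h
  exact left_eq_mul.1 h

theorem cocycle_inv (hσ : ∀ g h w, σ (g * h) w = σ g (h • w) * σ h w)
    (g : Γ) (w : Ω) : σ g⁻¹ w = (σ g (g⁻¹ • w))⁻¹ := by
  have h := hσ g g⁻¹ w
  rw [mul_inv_cancel, cocycle_one hσ] at h
  exact (inv_eq_of_mul_eq_one_right h.symm).symm

theorem smul_mem_cocycleBall
    (hσ : ∀ g h w, σ (g * h) w = σ g (h • w) * σ h w)
    {P : Set Γ} {U : Set M} {w₀ w : Ω} {n : ℕ} {g : Γ}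
    (hg : g ∈ Subgroup.closure P) (hw : w ∈ cocycleBall σ (Subgroup.closure P) U w₀ n)
    (hU : σ g w ∈ U) : g • w ∈ cocycleBall σ (Subgroup.closure P) U w₀ (n + 1) := by
  obtain ⟨t, ht, rfl, htU⟩ := hw
  refine ⟨g * t, mul_mem hg ht, mul_smul _ _ _, ?_⟩
  rw [hσ, pow_succ']
  exact Set.mul_mem_mul hU htU

/-- A trivial label contributes no factor to the product, so the radius of a ball counts only
crossings of edges with non-trivial labels. -/
theorem smul_mem_cocycleBall_of_eq_one
    (hσ : ∀ g h w, σ (g * h) w = σ g (h • w) * σ h w)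
    {P : Set Γ} {U : Set M} {w₀ w : Ω} {n : ℕ} {g : Γ}
    (hg : g ∈ Subgroup.closure P) (hw : w ∈ cocycleBall σ (Subgroup.closure P) U w₀ n)
    (hU : σ g w = 1) : g • w ∈ cocycleBall σ (Subgroup.closure P) U w₀ n := by
  obtain ⟨t, ht, rfl, htU⟩ := hw
  refine ⟨g * t, mul_mem hg ht, mul_smul _ _ _, ?_⟩
  rwa [hσ, hU, one_mul]

/-- Every point of an orbit is reached by crossing each edge of the orbital graph with a
non-trivial label at most once. -/
theorem exists_mem_pow_of_ncard_le
    (hσ : ∀ g h w, σ (g * h) w = σ g (h • w) * σ h w)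
    {P : Set Γ} {U : Set M} (hU1 : 1 ∈ U)
    (hUinv : ∀ u ∈ U, u⁻¹ ∈ U) (hUσ : ∀ p ∈ P, ∀ w, σ p w ∈ U) (w₀ : Ω) (N : ℕ)
    (hfin : {e : Γ × Ω | e.1 ∈ P ∧ e.2 ∈ MulAction.orbit (Subgroup.closure P) w₀ ∧
      σ e.1 e.2 ≠ 1}.Finite)
    (hN : {e : Γ × Ω | e.1 ∈ P ∧ e.2 ∈ MulAction.orbit (Subgroup.closure P) w₀ ∧
      σ e.1 e.2 ≠ 1}.ncard ≤ N) :
    ∀ h ∈ Subgroup.closure P, h • w₀ ∈ cocycleBall σ (Subgroup.closure P) U w₀ N := by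
  set D := {e : Γ × Ω | e.1 ∈ P ∧ e.2 ∈ MulAction.orbit (Subgroup.closure P) w₀ ∧
      σ e.1 e.2 ≠ 1} with hD
  set W := cocycleBall σ (Subgroup.closure P) U w₀ with hW
  have hWorb : ∀ n, W n ⊆ MulAction.orbit (Subgroup.closure P) w₀ := by
    rintro n _ ⟨t, ht, rfl, -⟩
    exact ⟨⟨t, ht⟩, rfl⟩
  have hPmem : ∀ p ∈ P, p ∈ Subgroup.closure P := fun p hp => Subgroup.subset_closure hp
  have hinvU : ∀ p ∈ P, ∀ w, σ p⁻¹ w ∈ U := fun p hp w => by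
    rw [cocycle_inv hσ]
    exact hUinv _ (hUσ p hp _)
  -- The active edges with both ends in the `n`-th ball. The ball either exhausts the orbit or
  -- acquires a new such edge each time the radius grows.
  let E : ℕ → Set (Γ × Ω) := fun n => {e ∈ D | e.2 ∈ W n ∧ e.1 • e.2 ∈ W n}
  have hEfin : ∀ n, (E n).Finite := fun n => hfin.subset (Set.sep_subset _ _)
  have hmono : ∀ n, W n ⊆ W (n + 1) := cocycleBall_subset_succ σ hU1 w₀
  have hgen : ∀ n, (∀ p ∈ P, ∀ w ∈ W n, p • w ∈ W n ∧ p⁻¹ • w ∈ W n) →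
      ∀ h ∈ Subgroup.closure P, h • w₀ ∈ W n := by
    intro n hcl h hh
    induction hh using Subgroup.closure_induction_left with
    | one => exact ⟨1, one_mem _, rfl, by
        rw [cocycle_one hσ]; exact Set.one_mem_pow hU1⟩
    | mul_left p hp y _ ih => rw [mul_smul]; exact (hcl p hp _ ih).1
    | inv_mul_cancel p hp y _ ih => rw [mul_smul]; exact (hcl p hp _ ih).2
  have key : ∀ n, (∀ h ∈ Subgroup.closure P, h • w₀ ∈ W n) ∨ n ≤ (E n).ncard := by
    intro n
    induction n with
    | zero => exact Or.inr (Nat.zero_le _)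
    | succ n ih =>
      rcases ih with ih | ih
      · exact Or.inl fun h hh => hmono n (ih h hh)
      by_cases hcl : ∀ p ∈ P, ∀ w ∈ W n, p • w ∈ W n ∧ p⁻¹ • w ∈ W n
      · exact Or.inl fun h hh => hmono n (hgen n hcl h hh)
      · right
        have hsub : E n ⊆ E (n + 1) := fun e he => ⟨he.1, hmono n he.2.1, hmono n he.2.2⟩
        suffices hss : E n ⊂ E (n + 1) by
          have := Set.ncard_lt_ncard hss (hEfin _)
          omega
        -- An edge leaving the ball, in either direction, must have a non-trivial label, and one
        -- more factor from `U` reaches its far end. It is therefore an active edge of the next ball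
        -- but not of this one.
        refine (Set.ssubset_iff_of_subset hsub).2 ?_
        push Not at hcl
        obtain ⟨p, hp, w, hw, hpw⟩ := hcl
        by_cases h1 : p • w ∈ W n
        · have h2 := hpw h1
          refine ⟨(p, p⁻¹ • w), ⟨⟨hp, hWorb (n + 1) ?_, ?_⟩, ?_, ?_⟩, fun h => h2 h.2.1⟩
          · exact smul_mem_cocycleBall hσ (inv_mem (hPmem p hp)) hw (hinvU p hp w)
          · intro h3
            exact h2 (smul_mem_cocycleBall_of_eq_one hσ (inv_mem (hPmem p hp)) hw
              (by rw [cocycle_inv hσ, h3, inv_one]))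
          · exact smul_mem_cocycleBall hσ (inv_mem (hPmem p hp)) hw (hinvU p hp w)
          · simpa using hmono n hw
        · exact ⟨(p, w), ⟨⟨hp, hWorb n hw, fun h3 => h1
            (smul_mem_cocycleBall_of_eq_one hσ (hPmem p hp) hw h3)⟩, hmono n hw,
            smul_mem_cocycleBall hσ (hPmem p hp) hw (hUσ p hp w)⟩, fun h => h1 h.2.2⟩
  rcases key N with h' | h'
  · exact h'
  -- There are at most `N` active edges in all, so the `N`-th ball contains both ends of each of
  -- them. No edge can then leave it.
  have hEN : E N = D := Set.eq_of_subset_of_ncard_le (Set.sep_subset _ _) (hN.trans h') hfin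
  refine hgen N fun p hp w hw => ⟨?_, ?_⟩
  · by_cases h3 : σ p w = 1
    · exact smul_mem_cocycleBall_of_eq_one hσ (hPmem p hp) hw h3
    · have : (p, w) ∈ E N := by rw [hEN]; exact ⟨hp, hWorb N hw, h3⟩
      exact this.2.2
  · by_cases h3 : σ p (p⁻¹ • w) = 1
    · exact smul_mem_cocycleBall_of_eq_one hσ (inv_mem (hPmem p hp)) hw
        (by rw [cocycle_inv hσ, h3, inv_one])
    · have : (p, p⁻¹ • w) ∈ E N := by
        rw [hEN]
        exact ⟨hp, hWorb (N + 1)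
          (smul_mem_cocycleBall hσ (inv_mem (hPmem p hp)) hw (hinvU p hp w)), h3⟩
      exact this.2.1

/-- A Schreier-type generation statement for the values of a cocycle on a stabilizer. -/
theorem cocycleStab_eq_closure
    (hσ : ∀ g h w, σ (g * h) w = σ g (h • w) * σ h w)
    {P : Set Γ} {U : Set M} (hU1 : 1 ∈ U)
    (hUinv : ∀ u ∈ U, u⁻¹ ∈ U) (hUσ : ∀ p ∈ P, ∀ w, σ p w ∈ U) (w₀ : Ω) (N : ℕ)
    (hfin : {e : Γ × Ω | e.1 ∈ P ∧ e.2 ∈ MulAction.orbit (Subgroup.closure P) w₀ ∧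
      σ e.1 e.2 ≠ 1}.Finite)
    (hN : {e : Γ × Ω | e.1 ∈ P ∧ e.2 ∈ MulAction.orbit (Subgroup.closure P) w₀ ∧
      σ e.1 e.2 ≠ 1}.ncard ≤ N) :
    Subgroup.closure ((cocycleStab σ hσ (Subgroup.closure P) w₀ : Set M) ∩ U ^ (2 * N + 1)) =
      cocycleStab σ hσ (Subgroup.closure P) w₀ := by
  refine le_antisymm ((Subgroup.closure_le _).2 Set.inter_subset_left) ?_
  set Q := cocycleStab σ hσ (Subgroup.closure P) w₀ with hQ
  set C := Subgroup.closure ((Q : Set M) ∩ U ^ (2 * N + 1)) with hC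
  have hball := exists_mem_pow_of_ncard_le hσ hU1 hUinv hUσ w₀ N hfin hN
  have hex : ∀ w, ∃ t : Γ, (∃ h ∈ Subgroup.closure P, h • w₀ = w) →
      t ∈ Subgroup.closure P ∧ t • w₀ = w ∧ σ t w₀ ∈ U ^ N := by
    intro w
    by_cases h : ∃ h ∈ Subgroup.closure P, h • w₀ = w
    · obtain ⟨g, hg, rfl⟩ := h
      obtain ⟨t, ht⟩ := hball g hg
      exact ⟨t, fun _ => ht⟩
    · exact ⟨1, fun h' => absurd h' h⟩
  choose t ht using hex
  have ht' : ∀ h ∈ Subgroup.closure P, t (h • w₀) ∈ Subgroup.closure P ∧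
      t (h • w₀) • w₀ = h • w₀ ∧ σ (t (h • w₀)) w₀ ∈ U ^ N := fun h hh => ht _ ⟨h, hh, rfl⟩
  have hpowinv : ∀ n, ∀ u ∈ U ^ n, u⁻¹ ∈ U ^ n := by
    intro n
    induction n with
    | zero => intro u hu; simpa using hu
    | succ n ih =>
      intro u hu
      rw [pow_succ] at hu
      obtain ⟨a, ha, b, hb, rfl⟩ := hu
      rw [pow_succ', mul_inv_rev]
      exact Set.mul_mem_mul (hUinv b hb) (ih a ha)
  have hloop : ∀ p, p ∈ Subgroup.closure P → (∀ w, σ p w ∈ U) → ∀ h ∈ Subgroup.closure P,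
      σ ((t ((p * h) • w₀))⁻¹ * p * t (h • w₀)) w₀ ∈ C ∧
      ((t ((p * h) • w₀))⁻¹ * p * t (h • w₀)) • w₀ = w₀ := by
    intro p hp hpU h hh
    obtain ⟨h1, h2, h3⟩ := ht' h hh
    obtain ⟨h4, h5, h6⟩ := ht' (p * h) (mul_mem hp hh)
    have hfix : ((t ((p * h) • w₀))⁻¹ * p * t (h • w₀)) • w₀ = w₀ := by
      rw [mul_smul, mul_smul, h2, inv_smul_eq_iff, h5, mul_smul]
    -- The Schreier generator goes out along one representative, across one edge and back along
    -- another, giving `N + 1 + N` factors.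
    refine ⟨Subgroup.subset_closure ⟨⟨_, mul_mem (mul_mem (inv_mem h4) hp) h1, hfix, rfl⟩, ?_⟩,
      hfix⟩
    rw [hσ, h2, hσ, cocycle_inv hσ, ← mul_smul p,
      inv_smul_eq_iff.2 h5.symm,
      show 2 * N + 1 = N + 1 + N by ring, pow_add, pow_add, pow_one]
    exact Set.mul_mem_mul (Set.mul_mem_mul (hpowinv _ _ h6) (hpU _)) h3
  obtain ⟨o1, o2, o3⟩ := ht' 1 (one_mem _)
  rw [one_smul] at o1 o2 o3
  -- The representative chosen for `w₀` need not be the identity, so its own label has to be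
  -- absorbed into `C`.
  have hbase : σ (t w₀) w₀ ∈ C := by
    refine Subgroup.subset_closure ⟨⟨_, o1, o2, rfl⟩, Set.pow_subset_pow_right hU1 ?_ o3⟩
    omega
  have hall : ∀ h ∈ Subgroup.closure P, σ ((t (h • w₀))⁻¹ * h) w₀ ∈ C := by
    intro h hh
    have hstep : ∀ p, p ∈ Subgroup.closure P → (∀ w, σ p w ∈ U) → ∀ h ∈ Subgroup.closure P,
        σ ((t (h • w₀))⁻¹ * h) w₀ ∈ C → σ ((t ((p * h) • w₀))⁻¹ * (p * h)) w₀ ∈ C := by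
      intro p hp hpU h hh ih
      have h1 := hloop p hp hpU h hh
      have h2 : (t ((p * h) • w₀))⁻¹ * (p * h) =
          ((t ((p * h) • w₀))⁻¹ * p * t (h • w₀)) * ((t (h • w₀))⁻¹ * h) := by group
      have h3 : ((t (h • w₀))⁻¹ * h) • w₀ = w₀ := by
        rw [mul_smul, inv_smul_eq_iff, (ht' h hh).2.1]
      rw [h2, hσ, h3]
      exact mul_mem h1.1 ih
    induction hh using Subgroup.closure_induction_left with
    | one =>
      rw [one_smul, mul_one, cocycle_inv hσ, inv_smul_eq_iff.2 o2.symm]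
      exact inv_mem hbase
    | mul_left p hp y hy ih =>
      exact hstep p (Subgroup.subset_closure hp) (hUσ p hp) y hy ih
    | inv_mul_cancel p hp y hy ih =>
      refine hstep p⁻¹ (inv_mem (Subgroup.subset_closure hp)) (fun w => ?_) y hy ih
      rw [cocycle_inv hσ]
      exact hUinv _ (hUσ p hp _)
  rintro _ ⟨h, hh, hhw, rfl⟩
  have h1 := hall h hh
  rw [hhw] at h1
  have h2 : h = t w₀ * ((t w₀)⁻¹ * h) := by group
  have h3 : ((t w₀)⁻¹ * h) • w₀ = w₀ := by rw [mul_smul, hhw, inv_smul_eq_iff, o2]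
  rw [h2, hσ, h3]
  exact mul_mem hbase h1

end Cocycle

/-! ### Matched descendants and their finiteness -/

namespace TreeAut

variable {d : ℕ}

open scoped Pointwise

/-- Pairs of tree automorphisms act componentwise on pairs of vertices. -/
instance pairAction : MulAction (TreeAut d × TreeAut d) (List (Fin d) × List (Fin d)) where
  smul p w := (p.1 w.1, p.2 w.2)
  one_smul _ := rfl
  mul_smul _ _ _ := rfl

theorem pair_smul (p : TreeAut d × TreeAut d) (w : List (Fin d) × List (Fin d)) :
    p • w = (p.1 w.1, p.2 w.2) := rfl

/-- The componentwise state of a pair of tree automorphisms at a pair of vertices. -/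
def pairState (p : TreeAut d × TreeAut d) (w : List (Fin d) × List (Fin d)) :
    TreeAut d × TreeAut d :=
  (p.1.state w.1, p.2.state w.2)

theorem pairState_mul (g h : TreeAut d × TreeAut d) (w : List (Fin d) × List (Fin d)) :
    pairState (g * h) w = pairState g (h • w) * pairState h w :=
  Prod.ext (state_mul _ _ _) (state_mul _ _ _)

/-- The group of the states at a pair of vertices of the elements of `H` that fix the pair. -/
def descendant (H : Subgroup (TreeAut d × TreeAut d)) (w : List (Fin d) × List (Fin d)) :
    Subgroup (TreeAut d × TreeAut d) :=
  cocycleStab pairState pairState_mul H w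

theorem mem_descendant {H : Subgroup (TreeAut d × TreeAut d)} {u v : List (Fin d)}
    {g : TreeAut d × TreeAut d} :
    g ∈ descendant H (u, v) ↔
      ∃ h ∈ H, (h.1 u = u ∧ h.2 v = v) ∧ (h.1.state u, h.2.state v) = g := by
  unfold descendant
  rw [mem_cocycleStab]
  simp only [pair_smul, Prod.mk.injEq, pairState]

theorem descendant_nil (H : Subgroup (TreeAut d × TreeAut d)) : descendant H ([], []) = H := by
  ext g
  rw [mem_descendant]
  constructor
  · rintro ⟨h, hh, -, rfl⟩
    simpa using hh
  · intro hg
    exact ⟨g, hg, by simp, by simp⟩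

theorem descendant_descendant (H : Subgroup (TreeAut d × TreeAut d)) (u v x y : List (Fin d)) :
    descendant (descendant H (u, v)) (x, y) = descendant H (u ++ x, v ++ y) := by
  ext g
  simp only [mem_descendant, append_fixed_iff, state_append]
  constructor
  · rintro ⟨_, ⟨h, hh, ⟨h1, h2⟩, rfl⟩, ⟨h3, h4⟩, rfl⟩
    exact ⟨h, hh, ⟨⟨h1, h3⟩, h2, h4⟩, rfl⟩
  · rintro ⟨h, hh, ⟨⟨h1, h3⟩, h2, h4⟩, rfl⟩
    exact ⟨_, ⟨h, hh, ⟨h1, h2⟩, rfl⟩, ⟨h3, h4⟩, rfl⟩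

/-- The two components of the elements of `H` fix the vertices `u` and `v` simultaneously. -/
def Matched (H : Subgroup (TreeAut d × TreeAut d)) (u v : List (Fin d)) : Prop :=
  ∀ h ∈ H, h.1 u = u ↔ h.2 v = v

theorem Matched.append {H : Subgroup (TreeAut d × TreeAut d)} {u v x y : List (Fin d)}
    (h1 : Matched H u v) (h2 : Matched (descendant H (u, v)) x y) :
    Matched H (u ++ x) (v ++ y) := by
  intro h hh
  rw [append_fixed_iff, append_fixed_iff]
  constructor
  · rintro ⟨h3, h4⟩
    have h5 := (h1 h hh).1 h3
    exact ⟨h5, (h2 _ (mem_descendant.2 ⟨h, hh, ⟨h3, h5⟩, rfl⟩)).1 h4⟩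
  · rintro ⟨h3, h4⟩
    have h5 := (h1 h hh).2 h3
    exact ⟨h5, (h2 _ (mem_descendant.2 ⟨h, hh, ⟨h5, h3⟩, rfl⟩)).2 h4⟩

/-- The descendants of `H` at matched pairs of vertices of equal level. -/
def matchedDescendants (H : Subgroup (TreeAut d × TreeAut d)) :
    Set (Subgroup (TreeAut d × TreeAut d)) :=
  {Q | ∃ u v, u.length = v.length ∧ Matched H u v ∧ descendant H (u, v) = Q}

theorem self_mem_matchedDescendants (H : Subgroup (TreeAut d × TreeAut d)) :
    H ∈ matchedDescendants H :=
  ⟨[], [], rfl, fun h _ => by simp, descendant_nil H⟩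

theorem descendant_mem_matchedDescendants {H Q : Subgroup (TreeAut d × TreeAut d)}
    (hQ : Q ∈ matchedDescendants H) {x y : List (Fin d)} (hxy : x.length = y.length)
    (h : Matched Q x y) : descendant Q (x, y) ∈ matchedDescendants H := by
  obtain ⟨u, v, huv, hm, rfl⟩ := hQ
  exact ⟨u ++ x, v ++ y, by simp [huv, hxy], hm.append h, (descendant_descendant H u v x y).symm⟩

theorem finite_length_eq (d m : ℕ) : {v : List (Fin d) | v.length = m}.Finite :=
  List.finite_length_eq (Fin d) m

/-- The edges with a non-trivial label in the orbital graph of a matched pair of vertices. -/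
theorem activeEdges_finite_and_ncard_le (P : Finset (TreeAut d × TreeAut d)) {k c : ℕ}
    (hk : P.card ≤ k)
    (hc : ∀ p ∈ P, ∀ m, {v | v.length = m ∧ p.1.state v ≠ 1}.ncard ≤ c ∧
      {v | v.length = m ∧ p.2.state v ≠ 1}.ncard ≤ c) {u v : List (Fin d)}
    (huv : u.length = v.length)
    (hm : Matched (Subgroup.closure (P : Set (TreeAut d × TreeAut d))) u v) :
    {e : (TreeAut d × TreeAut d) × (List (Fin d) × List (Fin d)) |
      e.1 ∈ (P : Set (TreeAut d × TreeAut d)) ∧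
      e.2 ∈ MulAction.orbit (Subgroup.closure (P : Set (TreeAut d × TreeAut d))) (u, v) ∧
      pairState e.1 e.2 ≠ 1}.Finite ∧
    {e : (TreeAut d × TreeAut d) × (List (Fin d) × List (Fin d)) |
      e.1 ∈ (P : Set (TreeAut d × TreeAut d)) ∧
      e.2 ∈ MulAction.orbit (Subgroup.closure (P : Set (TreeAut d × TreeAut d))) (u, v) ∧
      pairState e.1 e.2 ≠ 1}.ncard ≤ 2 * k * c := by
  classical
  set H := Subgroup.closure (P : Set (TreeAut d × TreeAut d)) with hH
  set m := u.length with hmu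
  set O := MulAction.orbit H (u, v) with hO
  have hlen : ∀ w ∈ O, w.1.length = m ∧ w.2.length = m := by
    rintro _ ⟨h, rfl⟩
    exact ⟨length_apply _ _, (length_apply _ _).trans huv.symm⟩
  -- Matching says that `u` and `v` have the same stabilizer in `H`, so either coordinate determines
  -- a point of the orbit of the pair. Active edges can thus be counted by the non-trivial states of
  -- one component on one level.
  have hinj1 : Set.InjOn Prod.fst O := by
    rintro _ ⟨g, rfl⟩ _ ⟨h, rfl⟩ he
    have he' : g.1.1 u = h.1.1 u := he
    have h1 := (hm _ (mul_mem (inv_mem g.2) h.2)).1 (by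
      change g.1.1.symm (h.1.1 u) = u
      rw [← he', RelIso.symm_apply_apply])
    have h2 : g.1.2.symm (h.1.2 v) = v := h1
    have h3 : h.1.2 v = g.1.2 v := (RelIso.symm_apply_eq _).1 h2
    exact Prod.ext he h3.symm
  have hinj2 : Set.InjOn Prod.snd O := by
    rintro _ ⟨g, rfl⟩ _ ⟨h, rfl⟩ he
    have he' : g.1.2 v = h.1.2 v := he
    have h1 := (hm _ (mul_mem (inv_mem g.2) h.2)).2 (by
      change g.1.2.symm (h.1.2 v) = v
      rw [← he', RelIso.symm_apply_apply])
    have h2 : g.1.1.symm (h.1.1 u) = u := h1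
    have h3 : h.1.1 u = g.1.1 u := (RelIso.symm_apply_eq _).1 h2
    exact Prod.ext h3.symm he
  have hone : ∀ p ∈ P, {w ∈ O | p.1.state w.1 ≠ 1}.Finite ∧
      {w ∈ O | p.1.state w.1 ≠ 1}.ncard ≤ c := by
    intro p hp
    have hmaps : Set.MapsTo Prod.fst {w ∈ O | p.1.state w.1 ≠ 1}
        {v | v.length = m ∧ p.1.state v ≠ 1} := fun w hw => ⟨(hlen w hw.1).1, hw.2⟩
    have hfin : {v : List (Fin d) | v.length = m ∧ p.1.state v ≠ 1}.Finite :=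
      (finite_length_eq d m).subset fun v hv => hv.1
    exact ⟨Set.Finite.of_injOn hmaps (hinj1.mono (Set.sep_subset _ _)) hfin,
      (Set.ncard_le_ncard_of_injOn _ hmaps (hinj1.mono (Set.sep_subset _ _)) hfin).trans
        (hc p hp m).1⟩
  have htwo : ∀ p ∈ P, {w ∈ O | p.2.state w.2 ≠ 1}.Finite ∧
      {w ∈ O | p.2.state w.2 ≠ 1}.ncard ≤ c := by
    intro p hp
    have hmaps : Set.MapsTo Prod.snd {w ∈ O | p.2.state w.2 ≠ 1}
        {v | v.length = m ∧ p.2.state v ≠ 1} := fun w hw => ⟨(hlen w hw.1).2, hw.2⟩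
    have hfin : {v : List (Fin d) | v.length = m ∧ p.2.state v ≠ 1}.Finite :=
      (finite_length_eq d m).subset fun v hv => hv.1
    exact ⟨Set.Finite.of_injOn hmaps (hinj2.mono (Set.sep_subset _ _)) hfin,
      (Set.ncard_le_ncard_of_injOn _ hmaps (hinj2.mono (Set.sep_subset _ _)) hfin).trans
        (hc p hp m).2⟩
  let F : TreeAut d × TreeAut d → Finset (List (Fin d) × List (Fin d)) := fun p =>
    if hp : p ∈ P then (hone p hp).1.toFinset ∪ (htwo p hp).1.toFinset else ∅
  have hF : ∀ p ∈ P, (F p).card ≤ 2 * c := by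
    intro p hp
    simp only [F, dif_pos hp]
    refine (Finset.card_union_le _ _).trans ?_
    rw [← Set.ncard_eq_toFinset_card _ (hone p hp).1, ← Set.ncard_eq_toFinset_card _ (htwo p hp).1]
    have h1 := (hone p hp).2
    have h2 := (htwo p hp).2
    omega
  have hsub : {e : (TreeAut d × TreeAut d) × (List (Fin d) × List (Fin d)) |
      e.1 ∈ (P : Set (TreeAut d × TreeAut d)) ∧ e.2 ∈ O ∧ pairState e.1 e.2 ≠ 1} ⊆
      ((P.sigma F).image fun x => (x.1, x.2) : Finset _) := by
    rintro ⟨p, w⟩ ⟨hp, hw, hne⟩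
    have hp' : p ∈ P := hp
    simp only [Finset.coe_image, Set.mem_image, Finset.mem_coe, Finset.mem_sigma]
    refine ⟨⟨p, w⟩, ⟨hp, ?_⟩, rfl⟩
    simp only [F, dif_pos hp', Finset.mem_union, Set.Finite.mem_toFinset, Set.mem_ofPred_eq]
    by_contra hcon
    push Not at hcon
    exact hne (Prod.ext (hcon.1 hw) (hcon.2 hw))
  refine ⟨(Finset.finite_toSet _).subset hsub, ?_⟩
  refine (Set.ncard_le_ncard hsub (Finset.finite_toSet _)).trans ?_
  rw [Set.ncard_coe_finset]
  refine Finset.card_image_le.trans ?_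
  rw [Finset.card_sigma]
  refine (Finset.sum_le_card_nsmul _ _ _ hF).trans ?_
  rw [smul_eq_mul]
  calc P.card * (2 * c) ≤ k * (2 * c) := Nat.mul_le_mul_right _ hk
    _ = 2 * k * c := by ring

/-- The bound for the number of descendants of a group generated by `k` pairs of automorphisms
that have at most `s` states, at most `c` of which are non-trivial on each level. -/
def descendantBound (k c s : ℕ) : ℕ :=
  2 ^ ((2 * (k * (s * s)) + 1) ^ (2 * (2 * k * c) + 1))

/-- With `N = 2 * k * c`, a descendant is generated by its intersection with the fixed finite set `U
^ (2 * N + 1)`, where `U` holds the identity, the pairs of states of the generators and their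
inverses. There are at most as many descendants as subsets of this power. -/
theorem matchedDescendants_finite_and_ncard_le (P : Finset (TreeAut d × TreeAut d)) {k c s : ℕ}
    (hk : P.card ≤ k)
    (hc : ∀ p ∈ P, ∀ m, {v | v.length = m ∧ p.1.state v ≠ 1}.ncard ≤ c ∧
      {v | v.length = m ∧ p.2.state v ≠ 1}.ncard ≤ c)
    (hs : ∀ p ∈ P, (Set.range p.1.state).Finite ∧ (Set.range p.2.state).Finite ∧
      (Set.range p.1.state).ncard ≤ s ∧ (Set.range p.2.state).ncard ≤ s) :
    (matchedDescendants (Subgroup.closure (P : Set (TreeAut d × TreeAut d)))).Finite ∧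
    (matchedDescendants (Subgroup.closure (P : Set (TreeAut d × TreeAut d)))).ncard ≤
      descendantBound k c s := by
  classical
  let S : TreeAut d × TreeAut d → Finset (TreeAut d × TreeAut d) := fun p =>
    if hp : p ∈ P then (hs p hp).1.toFinset ×ˢ (hs p hp).2.1.toFinset else ∅
  have hS : ∀ p ∈ P, (S p).card ≤ s * s := by
    intro p hp
    simp only [S, dif_pos hp, Finset.card_product]
    rw [← Set.ncard_eq_toFinset_card _ (hs p hp).1, ← Set.ncard_eq_toFinset_card _ (hs p hp).2.1]
    exact Nat.mul_le_mul (hs p hp).2.2.1 (hs p hp).2.2.2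
  set V := P.biUnion S with hV
  set U : Finset (TreeAut d × TreeAut d) := {1} ∪ (V ∪ V⁻¹) with hU
  have hVcard : V.card ≤ k * (s * s) :=
    (Finset.card_biUnion_le_card_mul _ _ _ hS).trans (Nat.mul_le_mul_right _ hk)
  have hUcard : U.card ≤ 2 * (k * (s * s)) + 1 := by
    have h1 : U.card ≤ 1 + (V ∪ V⁻¹).card := Finset.card_union_le _ _
    have h2 := Finset.card_union_le V V⁻¹
    rw [Finset.card_inv] at h2
    omega
  have hU1 : (1 : TreeAut d × TreeAut d) ∈ (U : Set (TreeAut d × TreeAut d)) := by simp [hU]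
  have hUinv : ∀ g ∈ (U : Set (TreeAut d × TreeAut d)), g⁻¹ ∈ (U : Set (TreeAut d × TreeAut d)) := by
    intro g hg
    simp only [hU, Finset.mem_coe, Finset.mem_union, Finset.mem_singleton, Finset.mem_inv',
      inv_inv, inv_eq_one] at hg ⊢
    tauto
  have hUσ : ∀ p ∈ (P : Set (TreeAut d × TreeAut d)), ∀ w,
      pairState p w ∈ (U : Set (TreeAut d × TreeAut d)) := by
    intro p hp w
    have hp' : p ∈ P := hp
    have : pairState p w ∈ V := by
      rw [hV, Finset.mem_biUnion]
      refine ⟨p, hp, ?_⟩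
      simp only [S, dif_pos hp', Finset.mem_product, Set.Finite.mem_toFinset]
      exact ⟨⟨_, rfl⟩, ⟨_, rfl⟩⟩
    simp [hU, this]
  set B := U ^ (2 * (2 * k * c) + 1) with hB
  have hBcard : B.card ≤ (2 * (k * (s * s)) + 1) ^ (2 * (2 * k * c) + 1) :=
    Finset.card_pow_le.trans (Nat.pow_le_pow_left hUcard _)
  let φ : Finset (TreeAut d × TreeAut d) → Subgroup (TreeAut d × TreeAut d) := fun s =>
    Subgroup.closure (s : Set (TreeAut d × TreeAut d))
  have hsub : matchedDescendants (Subgroup.closure (P : Set (TreeAut d × TreeAut d))) ⊆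
      (B.powerset.image φ : Finset _) := by
    rintro _ ⟨u, v, huv, hm, rfl⟩
    obtain ⟨hfin, hle⟩ := activeEdges_finite_and_ncard_le P hk hc huv hm
    have h := cocycleStab_eq_closure pairState_mul hU1 hUinv hUσ (u, v) (2 * k * c) hfin hle
    rw [Finset.coe_image, Set.mem_image]
    refine ⟨B.filter fun g => g ∈ descendant (Subgroup.closure (P : Set _)) (u, v), ?_, ?_⟩
    · exact Finset.mem_coe.2 (Finset.mem_powerset.2 (Finset.filter_subset _ _))
    · unfold descendant at *
      rw [← h]
      simp only [φ]
      congr 1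
      ext g
      simp only [Finset.coe_filter, Set.mem_ofPred_eq, h]
      rw [Set.mem_inter_iff, hB, ← Finset.coe_pow, and_comm]
      rfl
  refine ⟨(Finset.finite_toSet _).subset hsub, ?_⟩
  refine (Set.ncard_le_ncard hsub (Finset.finite_toSet _)).trans ?_
  rw [Set.ncard_coe_finset]
  refine Finset.card_image_le.trans ?_
  rw [Finset.card_powerset]
  exact Nat.pow_le_pow_right (by norm_num) hBcard

end TreeAut

/-! ### From conjugacy on a ball to conjugacy in the whole tree -/

namespace TreeAut

variable {d : ℕ}

/-- The map `h` is an automorphism of the ball of radius `n` of the tree. -/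
structure IsLevelAut (n : ℕ) (h : List (Fin d) → List (Fin d)) : Prop where
  length_eq : ∀ w, w.length ≤ n → (h w).length = w.length
  prefix_iff : ∀ u w, u.length ≤ n → w.length ≤ n → (h u <+: h w ↔ u <+: w)

/-- The components of the pairs in `P` are simultaneously conjugate on the ball of radius `n`. -/
def LevelConj (n : ℕ) (P : Set (TreeAut d × TreeAut d)) : Prop :=
  ∃ h : List (Fin d) → List (Fin d), IsLevelAut n h ∧
    ∀ p ∈ P, ∀ w, w.length ≤ n → p.1 (h w) = h (p.2 w)

theorem LevelConj.mono {n m : ℕ} {P : Set (TreeAut d × TreeAut d)} (h : LevelConj n P)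
    (hmn : m ≤ n) : LevelConj m P := by
  obtain ⟨h, ⟨h1, h2⟩, h3⟩ := h
  exact ⟨h, ⟨fun w hw => h1 w (hw.trans hmn), fun u w hu hw => h2 u w (hu.trans hmn)
    (hw.trans hmn)⟩, fun p hp w hw => h3 p hp w (hw.trans hmn)⟩

theorem LevelConj.closure {n : ℕ} {P : Set (TreeAut d × TreeAut d)} (h : LevelConj n P) :
    LevelConj n (Subgroup.closure P : Set (TreeAut d × TreeAut d)) := by
  obtain ⟨h, hh, h3⟩ := h
  refine ⟨h, hh, fun p hp => ?_⟩
  induction hp using Subgroup.closure_induction with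
  | mem p hp => exact h3 p hp
  | one => intro w _; rfl
  | mul p q _ _ ihp ihq =>
    intro w hw
    change p.1 (q.1 (h w)) = h (p.2 (q.2 w))
    rw [ihq w hw, ihp _ (by rwa [length_apply])]
  | inv p _ ih =>
    intro w hw
    change p.1.symm (h w) = h (p.2.symm w)
    rw [RelIso.symm_apply_eq, ih _ (by rwa [length_apply]), RelIso.apply_symm_apply]

theorem IsLevelAut.injective_of_le {n : ℕ} {h : List (Fin d) → List (Fin d)} (hh : IsLevelAut n h)
    {u w : List (Fin d)} (hu : u.length ≤ n) (hw : w.length ≤ n) (he : h u = h w) : u = w := by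
  have h1 := (hh.prefix_iff u w hu hw).1 (he ▸ List.prefix_rfl)
  refine h1.eq_of_length ?_
  rw [← hh.length_eq u hu, ← hh.length_eq w hw, he]

/-- The injection `π` is the action of the conjugator on the first level; deleting the first letter
of its values below `y` gives a conjugator for the descendant. -/
theorem LevelConj.exists_descend {n : ℕ} {H : Subgroup (TreeAut d × TreeAut d)}
    (hH : LevelConj (n + 1) (H : Set (TreeAut d × TreeAut d))) :
    ∃ π : Fin d → Fin d, Function.Injective π ∧
      (∀ p ∈ H, ∀ y y', p.2 [y] = [y'] → p.1 [π y] = [π y']) ∧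
      ∀ y, LevelConj n (descendant H ([π y], [y]) : Set (TreeAut d × TreeAut d)) := by
  obtain ⟨h, hh, hc⟩ := hH
  have hone : ∀ y : Fin d, ∃ x, h [y] = [x] := fun y =>
    List.length_eq_one_iff.1 (hh.length_eq [y] (by simp))
  choose π hπ using hone
  have hcons : ∀ (y : Fin d) (w : List (Fin d)), w.length ≤ n →
      h (y :: w) = π y :: (h (y :: w)).drop 1 := by
    intro y w hw
    obtain ⟨t, ht⟩ := (hh.prefix_iff [y] (y :: w) (by simp) (by simpa using hw)).2 (by simp)
    rw [← ht, hπ]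
    rfl
  refine ⟨π, ?_, ?_, ?_⟩
  · intro y y' hy
    have := hh.injective_of_le (u := [y]) (w := [y']) (by simp) (by simp) (by rw [hπ, hπ, hy])
    simpa using this
  · intro p hp y y' hy
    rw [← hπ, hc p hp [y] (by simp), hy, hπ]
  · intro y
    refine ⟨fun w => (h (y :: w)).drop 1, ⟨?_, ?_⟩, ?_⟩
    · intro w hw
      simp [hh.length_eq (y :: w) (by simpa using hw)]
    · intro u w hu hw
      have h1 := hh.prefix_iff (y :: u) (y :: w) (by simpa using hu) (by simpa using hw)
      rw [hcons y u hu, hcons y w hw] at h1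
      simpa using h1
    · intro g hg w hw
      obtain ⟨p, hp, ⟨h1, h2⟩, rfl⟩ := mem_descendant.1 hg
      have h3 := hc p hp (y :: w) (by simpa using hw)
      rw [hcons y w hw, apply_cons, h1, apply_cons p.2, h2] at h3
      have h4 := hcons y (p.2.state [y] w) (by rwa [length_apply])
      rw [List.singleton_append, List.singleton_append, h4] at h3
      exact (List.cons_injective h3)

theorem Matched.of_descend {H : Subgroup (TreeAut d × TreeAut d)} {π : Fin d → Fin d}
    (hπ : Function.Injective π) (hc : ∀ p ∈ H, ∀ y y', p.2 [y] = [y'] → p.1 [π y] = [π y'])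
    (y : Fin d) : Matched H [π y] [y] := by
  intro p hp
  obtain ⟨y', hy'⟩ := p.2.exists_apply_singleton y
  rw [hc p hp y y' hy', hy']
  simp [hπ.eq_iff]

/-- Conjugators of the descendants for different letters need not be compatible. One is kept for
each `H`-orbit of letters and carried to the rest of the orbit by elements of `H`. -/
theorem levelConj_succ_of_descend {n : ℕ} {H : Subgroup (TreeAut d × TreeAut d)}
    {π : Fin d → Fin d} (hπ : Function.Injective π)
    (hc : ∀ p ∈ H, ∀ y y', p.2 [y] = [y'] → p.1 [π y] = [π y'])
    (hd : ∀ y, LevelConj n (descendant H ([π y], [y]) : Set (TreeAut d × TreeAut d))) :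
    LevelConj (n + 1) (H : Set (TreeAut d × TreeAut d)) := by
  let r : Setoid (Fin d) :=
    { r := fun y y' => ∃ p ∈ H, p.2 [y] = [y']
      iseqv :=
        { refl := fun y => ⟨1, one_mem _, rfl⟩
          symm := by
            rintro y y' ⟨p, hp, h⟩
            exact ⟨p⁻¹, inv_mem hp, (RelIso.symm_apply_eq _).2 h.symm⟩
          trans := by
            rintro x y z ⟨p, hp, h⟩ ⟨q, hq, h'⟩
            exact ⟨q * p, mul_mem hq hp, by
              change q.2 (p.2 [x]) = [z]
              rw [h, h']⟩ } }
  let rep : Fin d → Fin d := fun y => (Quotient.mk r y).out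
  have hrep : ∀ y, ∃ p ∈ H, p.2 [rep y] = [y] := fun y =>
    Quotient.exact (Quotient.out_eq (Quotient.mk r y))
  have hrepeq : ∀ y y', (∃ p ∈ H, p.2 [y] = [y']) → rep y = rep y' := fun y y' h => by
    simp only [rep]
    rw [Quotient.sound (s := r) h]
  choose t htH ht using hrep
  choose f hf hfc using hd
  have ht1 : ∀ y, (t y).1 [π (rep y)] = [π y] := fun y => hc _ (htH y) _ _ (ht y)
  -- Below `y`: go back to the representative by the second component of `t y`, conjugate there, and
  -- return by the first component.
  let h : List (Fin d) → List (Fin d)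
    | [] => []
    | y :: w => π y :: (t y).1.state [π (rep y)]
        (f (rep y) (((t y).2.state [rep y]).symm w))
  have hcons : ∀ y w, h (y :: w) = π y :: (t y).1.state [π (rep y)]
        (f (rep y) (((t y).2.state [rep y]).symm w)) := fun _ _ => rfl
  refine ⟨h, ⟨?_, ?_⟩, ?_⟩
  · rintro (_ | ⟨y, w⟩) hw
    · rfl
    · have hw' : w.length ≤ n := by simpa using hw
      rw [hcons, List.length_cons, length_apply, (hf _).length_eq _ (by rwa [length_apply]),
        length_apply, List.length_cons]
  · rintro (_ | ⟨y, u⟩) (_ | ⟨z, w⟩) hu hw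
    · simp [h]
    · simp [h]
    · simp [h]
    · have hw' : w.length ≤ n := by simpa using hw
      have hu' : u.length ≤ n := by simpa using hu
      rw [hcons, hcons, List.cons_prefix_cons, List.cons_prefix_cons, hπ.eq_iff]
      refine and_congr_right ?_
      rintro rfl
      rw [TreeAut.prefix_iff, (hf _).prefix_iff _ _ (by rwa [length_apply])
        (by rwa [length_apply]), TreeAut.prefix_iff]
  · rintro p hp (_ | ⟨y, w⟩) hw
    · simp [h]
    have hw' : w.length ≤ n := by simpa using hw
    obtain ⟨y', hy'⟩ := p.2.exists_apply_singleton y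
    have hr : rep y = rep y' := hrepeq y y' ⟨p, hp, hy'⟩
    have hpy : p.1 [π y] = [π y'] := hc p hp y y' hy'
    have hty := ht y
    have hty1 := ht1 y
    rw [hr] at hty hty1
    set ρ := rep y' with hρ
    -- The loop from `ρ` via `y` and `y'` back to `ρ` fixes both base letters, so its states lie in
    -- the descendant that `f ρ` conjugates.
    have hq : ((t y')⁻¹ * p * t y).1 [π ρ] = [π ρ] ∧ ((t y')⁻¹ * p * t y).2 [ρ] = [ρ] := by
      constructor
      · change (t y').1.symm (p.1 ((t y).1 [π ρ])) = [π ρ]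
        rw [hty1, hpy, RelIso.symm_apply_eq, ht1]
      · change (t y').2.symm (p.2 ((t y).2 [ρ])) = [ρ]
        rw [hty, hy', RelIso.symm_apply_eq, ht]
    have hqmem := mem_descendant.2
      ⟨_, mul_mem (mul_mem (inv_mem (htH y')) hp) (htH y), hq, rfl⟩
    set q := (t y')⁻¹ * p * t y with hqdef
    have hcomm : t y' * q = p * t y := by rw [hqdef]; group
    have e1 : (t y').1.state [π ρ] * q.1.state [π ρ] = p.1.state [π y] * (t y).1.state [π ρ] := by
      have := congrArg (fun g : TreeAut d × TreeAut d => g.1.state [π ρ]) hcomm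
      simp only [Prod.fst_mul, state_mul] at this
      rwa [hq.1, hty1] at this
    have e2 : (t y').2.state [ρ] * q.2.state [ρ] = p.2.state [y] * (t y).2.state [ρ] := by
      have := congrArg (fun g : TreeAut d × TreeAut d => g.2.state [ρ]) hcomm
      simp only [Prod.snd_mul, state_mul] at this
      rwa [hq.2, hty] at this
    rw [hcons, hr, apply_cons, hpy, apply_cons p.2, hy', List.singleton_append,
      List.singleton_append, hcons, ← hρ]
    congr 1
    have h5 := hfc ρ _ hqmem (((t y).2.state [ρ]).symm w) (by rwa [length_apply])
    have h6 := congrArg (fun g : TreeAut d => g (f ρ (((t y).2.state [ρ]).symm w))) e1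
    have h7 := congrArg (fun g : TreeAut d => g (((t y).2.state [ρ]).symm w)) e2
    simp only [mul_apply, RelIso.apply_symm_apply] at h5 h6 h7
    rw [← h6, h5, ← h7, RelIso.symm_apply_apply]

/-- A conjugacy on a ball whose radius bounds the number of matched descendants extends to a
conjugacy on all balls. -/
theorem LevelConj.of_ncard_le {H : Subgroup (TreeAut d × TreeAut d)} {K : ℕ}
    (hfin : (matchedDescendants H).Finite) (hK : (matchedDescendants H).ncard ≤ K)
    (hH : LevelConj K (H : Set (TreeAut d × TreeAut d))) (n : ℕ) :
    LevelConj n (H : Set (TreeAut d × TreeAut d)) := by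
  let R : ℕ → Set (Subgroup (TreeAut d × TreeAut d)) := fun n =>
    {Q ∈ matchedDescendants H | LevelConj n (Q : Set (TreeAut d × TreeAut d))}
  have hRfin : ∀ n, (R n).Finite := fun n => hfin.subset (Set.sep_subset _ _)
  have hanti : ∀ n, R (n + 1) ⊆ R n := fun n Q hQ => ⟨hQ.1, hQ.2.mono n.le_succ⟩
  -- Conjugacy on radius `n + 2` depends only on conjugacy of the first-level descendants on radius
  -- `n + 1`, and these are matched descendants of `H` again.
  have hstep : ∀ n, R n ⊆ R (n + 1) → R (n + 1) ⊆ R (n + 2) := by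
    intro n hn Q hQ
    obtain ⟨π, hπ, hc, hd⟩ := hQ.2.exists_descend
    exact ⟨hQ.1, levelConj_succ_of_descend hπ hc fun y =>
      (hn ⟨descendant_mem_matchedDescendants hQ.1 (by simp) (Matched.of_descend hπ hc y), hd y⟩).2⟩
  have hcount : ∀ n, (∃ m < n, R m ⊆ R (m + 1)) ∨
      (R n).ncard + n ≤ (matchedDescendants H).ncard := by
    intro n
    induction n with
    | zero => exact Or.inr (Set.ncard_le_ncard (Set.sep_subset _ _) hfin)
    | succ n ih =>
      rcases ih with ⟨m, hm, h⟩ | ih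
      · exact Or.inl ⟨m, by omega, h⟩
      · by_cases h : R n ⊆ R (n + 1)
        · exact Or.inl ⟨n, by omega, h⟩
        · have := Set.ncard_lt_ncard (⟨hanti n, h⟩ : R (n + 1) ⊂ R n) (hRfin n)
          omega
  have hmem : H ∈ R K := ⟨self_mem_matchedDescendants H, hH⟩
  -- Without stabilization, `K` strict drops would leave no room for `H`, which still belongs to `R
  -- K`.
  have hstab : ∃ m ≤ K, R m ⊆ R (m + 1) := by
    rcases hcount K with ⟨m, hm, h⟩ | h
    · exact ⟨m, by omega, h⟩
    · have := Set.ncard_pos (hRfin K) |>.2 ⟨H, hmem⟩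
      omega
  obtain ⟨m, hmK, hm⟩ := hstab
  have hall : ∀ j, R (m + j) ⊆ R (m + j + 1) := by
    intro j
    induction j with
    | zero => exact hm
    | succ j ih => exact hstep _ ih
  have hall' : ∀ j, R m ⊆ R (m + j) := by
    intro j
    induction j with
    | zero => exact subset_rfl
    | succ j ih => exact ih.trans (hall j)
  have hHm : H ∈ R m := ⟨self_mem_matchedDescendants H, hH.mono hmK⟩
  exact (hall' n hHm).2.mono (Nat.le_add_left _ _)

/-- Compactness: each word has finitely many possible images, so the level conjugators have a
pointwise limit along a non-principal ultrafilter. Each required identity involves finitely many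
words and passes to the limit. -/
theorem exists_conj_of_forall_levelConj {P : Set (TreeAut d × TreeAut d)}
    (hP : ∀ n, LevelConj n P) : ∃ h : TreeAut d, ∀ p ∈ P, h⁻¹ * p.1 * h = p.2 := by
  choose f hf hfc using hP
  let F : Ultrafilter ℕ := Filter.hyperfilter ℕ
  have hge : ∀ m, ∀ᶠ n in (F : Filter ℕ), m ≤ n := fun m =>
    (Filter.Eventually.filter_mono (by
      rw [← Nat.cofinite_eq_atTop]; exact Filter.hyperfilter_le_cofinite)
      (Filter.eventually_ge_atTop m))
  have hlim : ∀ w : List (Fin d), ∃ u, ∀ᶠ n in (F : Filter ℕ), f n w = u := by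
    intro w
    have h1 : ∀ᶠ n in (F : Filter ℕ), ∃ u ∈ {u : List (Fin d) | u.length = w.length}, f n w = u := by
      filter_upwards [hge w.length] with n hn
      exact ⟨_, (hf n).length_eq w hn, rfl⟩
    obtain ⟨u, -, hu⟩ := (Ultrafilter.eventually_exists_mem_iff (finite_length_eq d w.length)).1 h1
    exact ⟨u, hu⟩
  choose h hh using hlim
  have hlen : ∀ w, (h w).length = w.length := by
    intro w
    obtain ⟨n, h1, h2⟩ := ((hh w).and (hge w.length)).exists
    rw [← h1, (hf n).length_eq w h2]
  have hpre : ∀ u w, h u <+: h w ↔ u <+: w := by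
    intro u w
    obtain ⟨n, h1, h2, h3, h4⟩ :=
      ((hh u).and ((hh w).and ((hge u.length).and (hge w.length)))).exists
    rw [← h1, ← h2, (hf n).prefix_iff u w h3 h4]
  have hinj : Function.Injective h := by
    intro u w he
    refine List.IsPrefix.eq_of_length ((hpre u w).1 (he ▸ List.prefix_rfl)) ?_
    rw [← hlen u, he, hlen]
  have hsurj : Function.Surjective h := by
    intro u
    have h1 : h '' {w | w.length = u.length} = {w | w.length = u.length} := by
      refine Set.eq_of_subset_of_ncard_le ?_ (Set.ncard_image_of_injective _ hinj).ge
        (finite_length_eq d u.length)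
      rintro _ ⟨w, hw, rfl⟩
      exact (hlen w).trans hw
    obtain ⟨w, -, hw⟩ : u ∈ h '' {w | w.length = u.length} := by rw [h1]; rfl
    exact ⟨w, hw⟩
  refine ⟨⟨Equiv.ofBijective h ⟨hinj, hsurj⟩, hpre _ _⟩, fun p hp => ?_⟩
  rw [mul_assoc, inv_mul_eq_iff_eq_mul]
  ext1 w
  change p.1 (h w) = h (p.2 w)
  obtain ⟨n, h1, h2, h3⟩ := ((hh w).and ((hh (p.2 w)).and (hge w.length))).exists
  rw [← h1, ← h2, hfc n p hp w h3]

theorem levelConj_of_conj {P : Set (TreeAut d × TreeAut d)} {h : TreeAut d}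
    (hh : ∀ p ∈ P, h⁻¹ * p.1 * h = p.2) (n : ℕ) : LevelConj n P := by
  refine ⟨h, ⟨fun w _ => h.length_apply w, fun u w _ _ => h.prefix_iff⟩, fun p hp w _ => ?_⟩
  have h1 := hh p hp
  rw [mul_assoc, inv_mul_eq_iff_eq_mul] at h1
  exact congrArg (fun g : TreeAut d => g w) h1

/-- Simultaneous conjugacy of generators in `Aut(T)` is detected on a ball whose radius bounds the
number of matched descendants. -/
theorem exists_conj_iff_levelConj {P : Set (TreeAut d × TreeAut d)} {K : ℕ}
    (hfin : (matchedDescendants (Subgroup.closure P)).Finite)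
    (hK : (matchedDescendants (Subgroup.closure P)).ncard ≤ K) :
    (∃ h : TreeAut d, ∀ p ∈ P, h⁻¹ * p.1 * h = p.2) ↔ LevelConj K P := by
  constructor
  · rintro ⟨h, hh⟩
    exact levelConj_of_conj hh K
  · intro h
    obtain ⟨g, hg⟩ := exists_conj_of_forall_levelConj (h.closure.of_ncard_le hfin hK)
    exact ⟨g, fun p hp => hg p (Subgroup.subset_closure hp)⟩

end TreeAut

/-! ### Loops of states: effective bounds for activity and triviality -/

namespace TreeAut

variable {d : ℕ}

theorem ncard_length_eq (d m : ℕ) : {v : List (Fin d) | v.length = m}.ncard = d ^ m := by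
  have h : Nat.card (List.Vector (Fin d) m) = d ^ m := by
    rw [Nat.card_eq_fintype_card, card_vector, Fintype.card_fin]
  exact h

theorem exists_active_of_ne_one {g : TreeAut d} (hg : g ≠ 1) :
    ∃ w x, g.state w [x] ≠ [x] := by
  by_contra! h
  refine hg ?_
  ext1 w
  rw [one_apply]
  induction w using List.reverseRecOn with
  | nil => exact apply_nil g
  | append_singleton w x ih => rw [apply_append_eq_state, ih, h]

/-- Two of the first `S + 1` prefixes of a word lead to the same state. -/
theorem exists_loop {g : TreeAut d} {S : ℕ} (hfin : (Set.range g.state).Finite)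
    (hS : (Set.range g.state).ncard ≤ S) {w : List (Fin d)} (hw : S ≤ w.length) :
    ∃ α β γ, w = α ++ β ++ γ ∧ β ≠ [] ∧ g.state (α ++ β) = g.state α := by
  classical
  have hcard : hfin.toFinset.card < (Finset.range (S + 1)).card := by
    rw [← Set.ncard_eq_toFinset_card _ hfin, Finset.card_range]
    omega
  obtain ⟨i, hi, j, hj, hij, he⟩ := Finset.exists_ne_map_eq_of_card_lt_of_maps_to hcard
    (f := fun i => g.state (w.take i)) (fun i _ => by simp)
  rw [Finset.mem_range] at hi hj
  wlog hlt : i < j generalizing i j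
  · exact this j hj i hi hij.symm he.symm (by omega)
  have h1 : w.take i ++ (w.drop i).take (j - i) = w.take j := by
    conv_rhs => rw [show j = i + (j - i) by omega, List.take_add]
  refine ⟨w.take i, (w.drop i).take (j - i), w.drop j, ?_, ?_, ?_⟩
  · rw [h1, List.take_append_drop]
  · intro h
    have := congrArg List.length h
    simp at this
    omega
  · rw [h1]
    exact he.symm

theorem range_state_state_subset (g : TreeAut d) (v : List (Fin d)) :
    Set.range (g.state v).state ⊆ Set.range g.state := by
  rintro _ ⟨w, rfl⟩
  exact ⟨v ++ w, state_append _ _ _⟩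

theorem state_append_flatten_replicate {g : TreeAut d} {α β : List (Fin d)}
    (h : g.state (α ++ β) = g.state α) (n : ℕ) :
    g.state (α ++ (List.replicate n β).flatten) = g.state α := by
  induction n with
  | zero => simp
  | succ n ih => rw [List.replicate_succ, List.flatten_cons, ← List.append_assoc, state_append, h,
      ← state_append, ih]

/-- Two successive loops through non-trivial states make the activity unbounded. -/
theorem not_isBounded_of_loops {g : TreeAut d} {α B u R y : List (Fin d)}
    (hB : g.state (α ++ B) = g.state α) (hR : g.state (α ++ u ++ R) = g.state (α ++ u))
    (hu : g.state (α ++ u) ≠ 1) (hlen : B.length = R.length) (hy : y <+: u)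
    (hyB : ¬ y <+: B) (hyl : y.length ≤ B.length) : ¬ g.IsBounded := by
  rintro ⟨-, C, hC⟩
  obtain ⟨w, x, hx⟩ := exists_active_of_ne_one hu
  -- Going `i` times round the first loop and `C - i` times round the second gives `C + 1` words of
  -- equal length, all with active state.
  let f : ℕ → List (Fin d) := fun i => α ++ ((List.replicate i B).flatten ++
    (u ++ ((List.replicate (C - i) R).flatten ++ w)))
  set ℓ := α.length + u.length + C * B.length + w.length with hℓ
  have hmaps : ∀ i ∈ Finset.range (C + 1),
      f i ∈ {v : List (Fin d) | v.length = ℓ ∧ ∃ x : Fin d, g.state v [x] ≠ [x]} := by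
    intro i hi
    rw [Finset.mem_range] at hi
    constructor
    · obtain ⟨j, rfl⟩ : ∃ j, C = i + j := ⟨C - i, by omega⟩
      simp only [f, List.length_append, List.length_flatten, List.map_replicate,
        List.sum_replicate, smul_eq_mul, hℓ, Nat.add_sub_cancel_left, ← hlen]
      ring
    · refine ⟨x, ?_⟩
      have h1 : g.state (f i) = (g.state (α ++ u)).state w := by
        simp only [f]
        rw [← List.append_assoc α, state_append, state_append_flatten_replicate hB,
          ← state_append, ← List.append_assoc, ← List.append_assoc, state_append,
          state_append_flatten_replicate hR]
      rwa [h1]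
  -- After cancelling the common `i` loops, one word continues with `u`, hence with `y`, and the
  -- other with `B`, which does not start with `y`.
  have hne : ∀ i j, i < j → j ≤ C → f i ≠ f j := by
    intro i j hij hj he
    have h1 := List.append_cancel_left he
    obtain ⟨k, rfl⟩ : ∃ k, j = i + (k + 1) := ⟨j - i - 1, by omega⟩
    rw [List.replicate_add, List.flatten_append, List.append_assoc, List.replicate_succ,
      List.flatten_cons] at h1
    have h2 := List.append_cancel_left h1
    rw [List.append_assoc] at h2
    have h3 : y <+: B ++ ((List.replicate k B).flatten ++
        (u ++ ((List.replicate (C - (i + (k + 1))) R).flatten ++ w))) := by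
      rw [← h2]
      exact hy.trans (List.prefix_append _ _)
    exact hyB (List.prefix_of_prefix_length_le h3 (List.prefix_append _ _) hyl)
  have hinj : Set.InjOn f (Finset.range (C + 1) : Set ℕ) := by
    intro i hi j hj he
    simp only [Finset.coe_range, Set.mem_Iio] at hi hj
    rcases lt_trichotomy i j with h | h | h
    · exact absurd he (hne i j h (by omega))
    · exact h
    · exact absurd he.symm (hne j i h (by omega))
  have h1 := Set.ncard_le_ncard_of_injOn f hmaps hinj
    ((finite_length_eq d ℓ).subset fun v hv => hv.1)
  rw [Set.ncard_coe_finset, Finset.card_range] at h1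
  have h2 := hC ℓ
  unfold activity at h2
  omega

theorem exists_branching {v v' : List (Fin d)} (hlen : v.length = v'.length) (hne : v ≠ v') :
    ∃ c x x' r r', x ≠ x' ∧ v = c ++ x :: r ∧ v' = c ++ x' :: r' := by
  induction v generalizing v' with
  | nil => exact absurd (List.eq_nil_of_length_eq_zero hlen.symm).symm hne
  | cons a v ih =>
    cases v' with
    | nil => simp at hlen
    | cons b v' =>
      by_cases hab : a = b
      · subst hab
        obtain ⟨c, x, x', r, r', h1, h2, h3⟩ := ih (by simpa using hlen) (fun h => hne (by rw [h]))
        exact ⟨a :: c, x, x', r, r', h1, by rw [h2]; rfl, by rw [h3]; rfl⟩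
      · exact ⟨[], a, b, v, v', hab, rfl, rfl⟩

/-- The word leaves the periodic path of the loop `β` through `y` and then runs long enough, through
non-trivial states, to contain a second loop. Two successive loops contradict boundedness. -/
theorem not_isBounded_of_branch {g : TreeAut d} {S : ℕ} (hfin : (Set.range g.state).Finite)
    (hS : (Set.range g.state).ncard ≤ S) {α β y r : List (Fin d)} (hβ : β ≠ []) (hy0 : y ≠ [])
    (hloop : g.state (α ++ β) = g.state α) (hr : S ≤ r.length)
    (halive : g.state (α ++ β ++ (y ++ r)) ≠ 1)
    (hy : ¬ y <+: (List.replicate y.length β).flatten) : ¬ g.IsBounded := by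
  have hsub := range_state_state_subset g (α ++ β ++ y)
  obtain ⟨r₁, r₂, r₃, rfl, hr₂, hloop₂⟩ := exists_loop (hfin.subset hsub)
    ((Set.ncard_le_ncard hsub hfin).trans hS) hr
  rw [← state_append, ← state_append] at hloop₂
  have hαβ : ∀ z, g.state (α ++ β ++ z) = g.state (α ++ z) := fun z => by
    rw [state_append, hloop, ← state_append]
  have hpos₂ := List.length_pos_iff.2 hr₂
  have hposβ := List.length_pos_iff.2 hβ
  have hposy := List.length_pos_iff.2 hy0
  obtain ⟨n, hn⟩ : ∃ n, r₂.length = n + 1 := ⟨r₂.length - 1, by omega⟩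
  have hBsplit : (List.replicate (y.length * r₂.length) β).flatten =
      (List.replicate y.length β).flatten ++ (List.replicate (y.length * n) β).flatten := by
    rw [hn, mul_add, mul_one, add_comm, List.replicate_add, List.flatten_append]
  have hlong : y.length ≤ ((List.replicate y.length β).flatten).length := by
    simp only [List.length_flatten, List.map_replicate, List.sum_replicate, smul_eq_mul]
    exact Nat.le_mul_of_pos_right _ hposβ
  -- The multiplicities of `β` and `r₂` equalize the lengths of the two loops; the common factor
  -- `y.length` makes the first at least as long as `y`.
  refine not_isBounded_of_loops (α := α) (u := y ++ r₁) (y := y)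
    (B := (List.replicate (y.length * r₂.length) β).flatten)
    (R := (List.replicate (y.length * β.length) r₂).flatten)
    (state_append_flatten_replicate hloop _) ?_ ?_ ?_ (List.prefix_append _ _) ?_ ?_
  · refine state_append_flatten_replicate ?_ _
    rw [List.append_assoc α, ← hαβ, ← hαβ]
    simpa only [List.append_assoc] using hloop₂
  · intro h1
    refine halive ?_
    rw [hαβ, show α ++ (y ++ (r₁ ++ r₂ ++ r₃)) = (α ++ (y ++ r₁)) ++ (r₂ ++ r₃) by simp,
      state_append, h1, state_one]
  · simp only [List.length_flatten, List.map_replicate, List.sum_replicate, smul_eq_mul]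
    ring
  · intro h1
    refine hy (List.prefix_of_prefix_length_le h1 ?_ hlong)
    rw [hBsplit]
    exact List.prefix_append _ _
  · rw [hBsplit, List.length_append]
    omega

/-- If the words differ, at least `S` letters precede and follow their first difference. The common
part before it contains a loop, and the two distinct letters cannot both continue the periodic path
of that loop, so one of the words branches off it. -/
theorem eq_of_take_eq_of_drop_eq {g : TreeAut d} (hg : g.IsBounded) {S : ℕ}
    (hS : (Set.range g.state).ncard ≤ S) {v v' : List (Fin d)} {m : ℕ} (hv : v.length = m)
    (hv' : v'.length = m) (hm : 2 * S ≤ m) (hne : g.state v ≠ 1) (hne' : g.state v' ≠ 1)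
    (ht : v.take S = v'.take S) (hd : v.drop (m - S) = v'.drop (m - S)) : v = v' := by
  by_contra hvv
  obtain ⟨c, x, x', r, r', hx, rfl, rfl⟩ := exists_branching (hv.trans hv'.symm) hvv
  simp only [List.length_append, List.length_cons] at hv hv'
  have hc : S ≤ c.length := by
    by_contra! h
    have h1 := congrArg (fun l : List (Fin d) => l[c.length]?) ht
    simp [h] at h1
    exact hx h1
  have hr : S ≤ r.length := by
    by_contra! h
    have h1 := congrArg (fun l : List (Fin d) => l[c.length - (m - S)]?) hd
    simp only [List.getElem?_drop] at h1
    rw [show m - S + (c.length - (m - S)) = c.length by omega] at h1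
    simp at h1
    exact hx h1
  have hr' : S ≤ r'.length := by omega
  obtain ⟨α, β, γ, rfl, hβ, hloop⟩ := exists_loop hg.1 hS hc
  have hor : ¬ (γ ++ [x]) <+: (List.replicate (γ ++ [x]).length β).flatten ∨
      ¬ (γ ++ [x']) <+: (List.replicate (γ ++ [x']).length β).flatten := by
    by_contra! h
    have h2 := h.2
    rw [show (γ ++ [x']).length = (γ ++ [x]).length by simp] at h2
    have h3 := List.prefix_of_prefix_length_le h.1 h2 (by simp)
    have h4 := h3.eq_of_length (by simp)
    simp at h4
    exact hx h4
  rcases hor with h | h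
  · exact not_isBounded_of_branch hg.1 hS hβ (by simp) hloop hr (by simpa using hne) h hg
  · exact not_isBounded_of_branch hg.1 hS hβ (by simp) hloop hr' (by simpa using hne') h hg

/-- An effective bound for the number of non-trivial states of a bounded automorphism on a level. -/
theorem IsBounded.ncard_state_ne_one_le {g : TreeAut d} (hg : g.IsBounded) {S : ℕ}
    (hS : (Set.range g.state).ncard ≤ S) (m : ℕ) :
    {v | v.length = m ∧ g.state v ≠ 1}.ncard ≤ (d + 1) ^ (2 * S) := by
  -- The base `d + 1` is positive even for `d = 0`, which monotonicity in the exponent requires.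
  have hd : ∀ n, d ^ n ≤ (d + 1) ^ n := fun n => Nat.pow_le_pow_left d.le_succ n
  rcases lt_or_ge m (2 * S) with hm | hm
  · calc {v | v.length = m ∧ g.state v ≠ 1}.ncard
        ≤ {v : List (Fin d) | v.length = m}.ncard :=
          Set.ncard_le_ncard (fun v hv => hv.1) (finite_length_eq d m)
      _ = d ^ m := ncard_length_eq d m
      _ ≤ (d + 1) ^ m := hd m
      _ ≤ (d + 1) ^ (2 * S) := Nat.pow_le_pow_right (Nat.succ_pos d) hm.le
  · have h := Set.ncard_le_ncard_of_injOn
      (s := {v | v.length = m ∧ g.state v ≠ 1})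
      (t := {v : List (Fin d) | v.length = S} ×ˢ {v : List (Fin d) | v.length = S})
      (fun v => (v.take S, v.drop (m - S)))
      (by
        rintro v ⟨hv, -⟩
        simp only [Set.mem_prod, Set.mem_ofPred_eq, List.length_take, List.length_drop, hv]
        omega)
      (by
        rintro v ⟨hv, hne⟩ v' ⟨hv', hne'⟩ he
        simp only [Prod.mk.injEq] at he
        exact eq_of_take_eq_of_drop_eq hg hS hv hv' hm hne hne' he.1 he.2)
      ((finite_length_eq d S).prod (finite_length_eq d S))
    rw [Set.ncard_prod, ncard_length_eq] at h
    refine h.trans ((Nat.mul_le_mul (hd S) (hd S)).trans (le_of_eq ?_))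
    rw [← pow_add, two_mul]

/-- An automorphism with at most `n` states is trivial if it is trivial up to level `n`. -/
theorem eq_one_of_forall_length_le {g : TreeAut d} {n : ℕ} (hfin : (Set.range g.state).Finite)
    (hn : (Set.range g.state).ncard ≤ n) (h : ∀ w, w.length ≤ n → g w = w) : g = 1 := by
  have key : ∀ N, ∀ w : List (Fin d), w.length ≤ N → g w = w := by
    intro N
    induction N with
    | zero => exact fun w hw => h w (by omega)
    | succ N ih =>
      intro w hw
      by_cases hwn : w.length ≤ n
      · exact h w hwn
      · obtain ⟨w, x, rfl⟩ := List.eq_nil_or_concat' w |>.resolve_left (by rintro rfl; simp at hwn)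
        rw [List.length_append, List.length_singleton] at hw hwn
        -- The last letter is kept out of the search for a loop, so both `α ++ β` and the word with
        -- `β` cut out are strictly shorter than the whole word and the induction hypothesis covers
        -- them.
        obtain ⟨α, β, γ, rfl, hβ, he⟩ := exists_loop hfin hn (w := w) (by omega)
        have hpos := List.length_pos_iff.2 hβ
        simp only [List.length_append] at hw
        have h1 : g (α ++ β) = α ++ β := ih _ (by simp only [List.length_append]; omega)
        have h2 : g (α ++ (γ ++ [x])) = α ++ (γ ++ [x]) :=
          ih _ (by simp only [List.length_append, List.length_singleton]; omega)
        rw [List.append_assoc (α ++ β), append_fixed_iff, he]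
        exact ⟨h1, ((append_fixed_iff _ _ _).1 h2).2⟩
  ext1 w
  exact key _ w le_rfl

end TreeAut

/-! ### A bound for finite orders -/

namespace TreeAut

variable {d : ℕ}

open scoped Pointwise

theorem range_state_pow (g : TreeAut d) {s : ℕ} (hfin : (Set.range g.state).Finite)
    (hs : (Set.range g.state).ncard ≤ s) (m : ℕ) :
    (Set.range (g ^ m).state).Finite ∧ (Set.range (g ^ m).state).ncard ≤ s ^ m := by
  classical
  have hsub : Set.range (g ^ m).state ⊆ ((hfin.toFinset ^ m : Finset (TreeAut d)) : Set _) := by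
    rw [Finset.coe_pow, Set.Finite.coe_toFinset]
    induction m with
    | zero =>
      rintro _ ⟨v, rfl⟩
      simp
    | succ m ih =>
      rintro _ ⟨v, rfl⟩
      rw [pow_succ g m, state_mul, pow_succ]
      exact Set.mul_mem_mul (ih ⟨_, rfl⟩) ⟨_, rfl⟩
  refine ⟨(Finset.finite_toSet _).subset hsub, ?_⟩
  refine (Set.ncard_le_ncard hsub (Finset.finite_toSet _)).trans ?_
  rw [Set.ncard_coe_finset]
  refine Finset.card_pow_le.trans (Nat.pow_le_pow_left ?_ _)
  rwa [← Set.ncard_eq_toFinset_card _ hfin]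

theorem pow_eq_one_iff_of_ncard_le (g : TreeAut d) {s : ℕ} (hfin : (Set.range g.state).Finite)
    (hs : (Set.range g.state).ncard ≤ s) {m n : ℕ} (hn : s ^ m ≤ n) :
    g ^ m = 1 ↔ ∀ w : List (Fin d), w.length ≤ n → (g ^ m) w = w := by
  constructor
  · rintro h w -
    rw [h, one_apply]
  · obtain ⟨h1, h2⟩ := g.range_state_pow hfin hs m
    exact eq_one_of_forall_length_le h1 (h2.trans hn)

theorem state_inv (g : TreeAut d) (v : List (Fin d)) : g⁻¹.state v = (g.state (g⁻¹ v))⁻¹ := by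
  have h := state_mul g g⁻¹ v
  rw [mul_inv_cancel, state_one] at h
  exact (inv_eq_of_mul_eq_one_right h.symm).symm

theorem state_pow_of_fixed {g : TreeAut d} {v : List (Fin d)} (h : g v = v) (n : ℕ) :
    (g ^ n).state v = (g.state v) ^ n := by
  induction n with
  | zero => simp
  | succ n ih => rw [pow_succ, state_mul, h, ih, pow_succ]

theorem inv_fixed {g : TreeAut d} {v : List (Fin d)} (h : g v = v) : g⁻¹ v = v :=
  (RelIso.symm_apply_eq g).2 h.symm

theorem pow_fixed {g : TreeAut d} {v : List (Fin d)} (h : g v = v) (n : ℕ) : (g ^ n) v = v := by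
  induction n with
  | zero => rfl
  | succ n ih => rw [pow_succ, mul_apply, h, ih]

theorem state_zpow_of_fixed {g : TreeAut d} {v : List (Fin d)} (h : g v = v) (n : ℤ) :
    (g ^ n).state v = (g.state v) ^ n := by
  cases n with
  | ofNat n => simpa using state_pow_of_fixed h n
  | negSucc n =>
    rw [zpow_negSucc, zpow_negSucc, state_inv, inv_fixed (pow_fixed h _), state_pow_of_fixed h]

/-- The diagonal cyclic group generated by an automorphism. -/
def diagonal (a : TreeAut d) : Subgroup (TreeAut d × TreeAut d) :=
  Subgroup.closure {(a, a)}

theorem mem_diagonal {a : TreeAut d} {p : TreeAut d × TreeAut d} :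
    p ∈ diagonal a ↔ ∃ k : ℤ, (a ^ k, a ^ k) = p := by
  rw [diagonal, Subgroup.mem_closure_singleton]
  rfl

theorem descendant_diagonal_mem (a : TreeAut d) (v : List (Fin d)) :
    descendant (diagonal a) (v, v) ∈ matchedDescendants (diagonal a) := by
  refine ⟨v, v, rfl, ?_, rfl⟩
  intro h hh
  obtain ⟨k, rfl⟩ := mem_diagonal.1 hh
  rfl

theorem pow_apply_eq_iff {a : TreeAut d} {v : List (Fin d)} {n : ℕ} :
    (a ^ n) v = v ↔ MulAction.period a v ∣ n := by
  rw [← MulAction.pow_smul_eq_iff_period_dvd]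
  rfl

theorem zpow_apply_eq_iff {a : TreeAut d} {v : List (Fin d)} {n : ℤ} :
    (a ^ n) v = v ↔ (MulAction.period a v : ℤ) ∣ n := by
  rw [← MulAction.zpow_smul_eq_iff_period_dvd]
  rfl

theorem period_dvd_period_append (a : TreeAut d) (v u : List (Fin d)) :
    MulAction.period a v ∣ MulAction.period a (v ++ u) := by
  rw [← pow_apply_eq_iff]
  exact ((append_fixed_iff _ _ _).1 (pow_apply_eq_iff.2 dvd_rfl)).1

theorem period_pos {a : TreeAut d} (ha : IsOfFinOrder a) (v : List (Fin d)) :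
    0 < MulAction.period a v :=
  Nat.pos_of_dvd_of_pos (MulAction.period_dvd_orderOf a v) ha.orderOf_pos

/-- An automorphism of finite order that returns to itself as a state of its power by an orbit
length fixes the vertex of return. -/
theorem apply_eq_of_zpow_state_eq {b : TreeAut d} (hb : IsOfFinOrder b) {u : List (Fin d)} {s : ℤ}
    (hu : (b ^ s) u = u) (hs : (b ^ s).state u = b) : b u = u := by
  obtain ⟨t, ht⟩ := zpow_apply_eq_iff.1 hu
  obtain ⟨l, hl⟩ := MulAction.period_dvd_orderOf b u
  have hpos := hb.orderOf_pos
  have hl0 : 0 < l := Nat.pos_of_ne_zero (by rintro rfl; omega)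
  -- Here `l` is the order of `b` divided by the orbit length of `u`. As `s` is a multiple of that
  -- length, `b ^ (s * l)` is trivial, and its state at `u` is `b ^ l`; so the orbit length must be
  -- `1`.
  have h1 : b ^ l = 1 := by
    have h2 := state_pow_of_fixed hu l
    rw [hs, ← zpow_natCast, ← zpow_mul, ht,
      show (MulAction.period b u : ℤ) * t * l = ((MulAction.period b u * l : ℕ) : ℤ) * t by
        push_cast; ring, ← hl, zpow_mul, zpow_natCast, pow_orderOf_eq_one, one_zpow,
      state_one] at h2
    exact h2.symm
  have h3 := Nat.le_of_dvd hl0 (orderOf_dvd_of_pow_eq_one h1)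
  have h4 : MulAction.period b u = 1 := by
    have h5 := period_pos hb u
    rw [hl] at h3
    have h6 : MulAction.period b u * l ≤ 1 * l := by omega
    have := Nat.le_of_mul_le_mul_right h6 hl0
    omega
  have h7 := pow_apply_eq_iff (a := b) (v := u) (n := 1)
  rw [pow_one, h4] at h7
  exact h7.2 dvd_rfl

/-- With `m` the orbit length of `v`, the state `b` of `a ^ m` at `v` must, by equality of the
descendants, also be the state at `v ++ u` of some power of `a` fixing that vertex. Hence some `b ^
s` fixes `u` and has state `b` there, which for finite order forces `b` to fix `u`. -/
theorem period_append_eq {a : TreeAut d} (ha : IsOfFinOrder a) {v u : List (Fin d)}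
    (h : descendant (diagonal a) (v, v) = descendant (diagonal a) (v ++ u, v ++ u)) :
    MulAction.period a (v ++ u) = MulAction.period a v := by
  refine Nat.dvd_antisymm ?_ (period_dvd_period_append a v u)
  set m := MulAction.period a v with hm
  have hfix : (a ^ m) v = v := pow_apply_eq_iff.2 dvd_rfl
  have hmem : ((a ^ m).state v, (a ^ m).state v) ∈ descendant (diagonal a) (v, v) :=
    mem_descendant.2 ⟨(a ^ m, a ^ m), mem_diagonal.2 ⟨m, by simp⟩, ⟨hfix, hfix⟩, rfl⟩
  rw [h, mem_descendant] at hmem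
  obtain ⟨p, hp, ⟨h1, -⟩, h2⟩ := hmem
  obtain ⟨k, rfl⟩ := mem_diagonal.1 hp
  have h3 : (a ^ k).state (v ++ u) = (a ^ m).state v := congrArg Prod.fst h2
  have h1' : (a ^ k) (v ++ u) = v ++ u := h1
  obtain ⟨h4, h5⟩ := (append_fixed_iff _ _ _).1 h1'
  obtain ⟨s, rfl⟩ := zpow_apply_eq_iff.1 h4
  rw [← hm, zpow_mul, zpow_natCast] at h3 h5
  rw [state_zpow_of_fixed hfix] at h5
  rw [state_append, state_zpow_of_fixed hfix] at h3
  rw [← pow_apply_eq_iff, append_fixed_iff]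
  refine ⟨hfix, apply_eq_of_zpow_state_eq ?_ h5 h3⟩
  obtain ⟨n, hn, hn1⟩ := isOfFinOrder_iff_pow_eq_one.1 ha
  refine isOfFinOrder_iff_pow_eq_one.2 ⟨n, hn, ?_⟩
  rw [← state_pow_of_fixed hfix, ← pow_mul, mul_comm, pow_mul, hn1, one_pow, state_one]

/-- Passing to a child multiplies the orbit length by at most the length of an orbit of the
returning state on the `d` letters. -/
theorem period_append_singleton_le {a : TreeAut d} (ha : IsOfFinOrder a) (v : List (Fin d))
    (x : Fin d) : MulAction.period a (v ++ [x]) ≤ MulAction.period a v * (d + 1) := by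
  set m := MulAction.period a v with hm
  have hmpos : 0 < m := period_pos ha v
  have hfix : (a ^ m) v = v := pow_apply_eq_iff.2 dvd_rfl
  set b := (a ^ m).state v with hb
  have hbfin : IsOfFinOrder b := by
    obtain ⟨n, hn, hn1⟩ := isOfFinOrder_iff_pow_eq_one.1 ha
    refine isOfFinOrder_iff_pow_eq_one.2 ⟨n, hn, ?_⟩
    rw [hb, ← state_pow_of_fixed hfix, ← pow_mul, mul_comm, pow_mul, hn1, one_pow, state_one]
  set r := MulAction.period b [x] with hr
  have hrpos : 0 < r := period_pos hbfin [x]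
  have hrd : r ≤ d := by
    have h := Set.ncard_le_ncard_of_injOn (s := Set.Iio r)
      (t := {w : List (Fin d) | w.length = 1}) (fun i => (fun w => b • w)^[i] [x])
      (by
        intro i _
        simp only [smul_iterate]
        exact length_apply _ _)
      (by rw [hr, MulAction.period_eq_minimalPeriod]; exact Function.iterate_injOn_Iio_minimalPeriod)
      (finite_length_eq d 1)
    rw [ncard_length_eq, pow_one, ← Finset.coe_Iio, Set.ncard_coe_finset, Nat.card_Iio] at h
    exact h
  have hdvd : MulAction.period a (v ++ [x]) ∣ m * r := by
    rw [← pow_apply_eq_iff, append_fixed_iff, pow_mul, state_pow_of_fixed hfix, ← hb]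
    exact ⟨pow_fixed hfix _, pow_apply_eq_iff.2 dvd_rfl⟩
  exact (Nat.le_of_dvd (Nat.mul_pos hmpos hrpos) hdvd).trans (Nat.mul_le_mul_left _ (by omega))

theorem period_le {a : TreeAut d} (ha : IsOfFinOrder a) {K : ℕ}
    (hfin : (matchedDescendants (diagonal a)).Finite)
    (hK : (matchedDescendants (diagonal a)).ncard ≤ K) (v : List (Fin d)) :
    MulAction.period a v ≤ (d + 1) ^ K := by
  classical
  -- The descendants met along the path to `v`; the orbit length is bounded by one factor `d + 1`
  -- for each distinct one.
  let D : List (Fin d) → Finset (Subgroup (TreeAut d × TreeAut d)) := fun v =>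
    v.inits.toFinset.image fun u => descendant (diagonal a) (u, u)
  have hD : ∀ v, (D v).card ≤ K := by
    intro v
    rw [← Set.ncard_coe_finset]
    refine (Set.ncard_le_ncard ?_ hfin).trans hK
    intro Q hQ
    simp only [D, Finset.coe_image, Set.mem_image] at hQ
    obtain ⟨u, -, rfl⟩ := hQ
    exact descendant_diagonal_mem a u
  have hmem : ∀ u v, u <+: v → descendant (diagonal a) (u, u) ∈ D v := fun u v huv =>
    Finset.mem_image.2 ⟨u, by simpa using huv, rfl⟩
  have key : MulAction.period a v ≤ (d + 1) ^ (D v).card := by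
    induction v using List.reverseRecOn with
    | nil =>
      have : MulAction.period a ([] : List (Fin d)) ∣ 1 := pow_apply_eq_iff.1 (by simp)
      rw [Nat.dvd_one.1 this]
      exact Nat.one_le_pow _ _ (Nat.succ_pos d)
    | append_singleton v x ih =>
      have hsub : D v ⊆ D (v ++ [x]) := by
        refine Finset.image_subset_image fun u hu => ?_
        simp only [List.mem_toFinset, List.mem_inits] at hu ⊢
        exact hu.trans (List.prefix_append _ _)
      by_cases hin : descendant (diagonal a) (v ++ [x], v ++ [x]) ∈ D v
      · obtain ⟨u, hu, he⟩ := Finset.mem_image.1 hin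
        simp only [List.mem_toFinset, List.mem_inits] at hu
        obtain ⟨t, rfl⟩ := hu
        rw [List.append_assoc] at he
        have h1 := period_append_eq ha he
        rw [List.append_assoc, h1]
        refine (Nat.le_of_dvd (period_pos ha _) (period_dvd_period_append a u t)).trans
          (ih.trans (Nat.pow_le_pow_right (Nat.succ_pos d) (Finset.card_le_card ?_)))
        rwa [← List.append_assoc]
      · have hlt : (D v).card + 1 ≤ (D (v ++ [x])).card :=
          Finset.card_lt_card ((Finset.ssubset_iff_of_subset hsub).2
            ⟨_, hmem _ _ List.prefix_rfl, hin⟩)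
        refine (period_append_singleton_le ha v x).trans ((Nat.mul_le_mul_right _ ih).trans ?_)
        rw [← pow_succ]
        exact Nat.pow_le_pow_right (Nat.succ_pos d) hlt
  exact key.trans (Nat.pow_le_pow_right (Nat.succ_pos d) (hD v))

/-- An effective bound for the finite orders. -/
theorem orderOf_le {a : TreeAut d} {K : ℕ} (hfin : (matchedDescendants (diagonal a)).Finite)
    (hK : (matchedDescendants (diagonal a)).ncard ≤ K) :
    orderOf a ≤ ((d + 1) ^ K).factorial := by
  by_cases ha : IsOfFinOrder a
  · refine orderOf_le_of_pow_eq_one (Nat.factorial_pos _) ?_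
    ext1 v
    rw [one_apply, pow_apply_eq_iff]
    exact Nat.dvd_factorial (period_pos ha v) (period_le ha hfin hK v)
  · rw [orderOf_eq_zero ha]
    exact Nat.zero_le _

end TreeAut

/-! ### Algorithms on codes of automata -/

/-- The type of the descriptions of automata that are handed to an algorithm. -/
abbrev AutomatonCode : Type := ℕ × List (List (ℕ × ℕ))

/-- The word that the automaton with the description `c` outputs on the input word `w`. -/
def runCode (c : AutomatonCode) (w : List ℕ) : List ℕ :=
  (w.foldl (fun st x =>
    (((c.2.getD st.1 []).getD x (0, 0)).2, st.2 ++ [((c.2.getD st.1 []).getD x (0, 0)).1]))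
    (c.1, ([] : List ℕ))).2

/-- All lists of length `k` with entries from `L`. -/
def tuples {α : Type*} (L : List α) (k : ℕ) : List (List α) :=
  Nat.rec [[]] (fun _ acc => acc.flatMap fun t => L.map fun x => x :: t) k

theorem mem_tuples {α : Type*} {L : List α} {k : ℕ} {t : List α} :
    t ∈ tuples L k ↔ t.length = k ∧ ∀ x ∈ t, x ∈ L := by
  induction k generalizing t with
  | zero =>
    have h : tuples L 0 = [[]] := rfl
    rw [h, List.mem_singleton, List.length_eq_zero_iff]
    exact ⟨by rintro rfl; simp, fun h => h.1⟩
  | succ k ih =>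
    have h : tuples L (k + 1) = (tuples L k).flatMap fun t => L.map fun x => x :: t := rfl
    rw [h, List.mem_flatMap]
    simp only [List.mem_map, ih]
    constructor
    · rintro ⟨s, ⟨h1, h2⟩, x, hx, rfl⟩
      exact ⟨by simp [h1], by simpa using ⟨hx, h2⟩⟩
    · rintro ⟨h1, h2⟩
      cases t with
      | nil => simp at h1
      | cons x s =>
        rw [List.forall_mem_cons] at h2
        exact ⟨s, ⟨by simpa using h1, h2.2⟩, x, h2.1, rfl⟩

/-- All words of length at most `n` over the alphabet `{0, …, d - 1}`. -/
def wordsUpTo (d n : ℕ) : List (List ℕ) :=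
  (List.range (n + 1)).flatMap (tuples (List.range d))

/-- The value at `w` of the function on `ws` whose list of values is `hs`. -/
def tableLookup (ws hs : List (List ℕ)) (w : List ℕ) : List ℕ :=
  hs.getD (ws.idxOf w) []

/-- The list of values `hs` on the list of words `ws` defines a level automorphism that conjugates
the automata in the list `L`. -/
def IsConjugatingTable (ws hs : List (List ℕ)) (L : List (AutomatonCode × AutomatonCode)) : Prop :=
  (∀ w ∈ ws, (tableLookup ws hs w).length = w.length) ∧
  (∀ u ∈ ws, ∀ w ∈ ws, (tableLookup ws hs u = (tableLookup ws hs w).take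
    (tableLookup ws hs u).length ∧ u = w.take u.length) ∨
    (¬ tableLookup ws hs u = (tableLookup ws hs w).take
      (tableLookup ws hs u).length ∧ ¬ u = w.take u.length)) ∧
  ∀ p ∈ L, ∀ w ∈ ws, runCode p.1 (tableLookup ws hs w) = tableLookup ws hs (runCode p.2 w)

/-- The finite test for simultaneous conjugacy on level `n`. -/
def ConjTest (d n : ℕ) (L : List (AutomatonCode × AutomatonCode)) : Prop :=
  ∃ hs ∈ tuples (wordsUpTo d n) (wordsUpTo d n).length, IsConjugatingTable (wordsUpTo d n) hs L

/-- The total number of states of the automata in the list `L`. -/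
def totalSize (L : List (AutomatonCode × AutomatonCode)) : ℕ :=
  L.foldr (fun p n => p.1.2.length + p.2.2.length + n) 0

/-- The level on which conjugacy is tested. -/
def testLevel (d s : ℕ) : ℕ :=
  TreeAut.descendantBound s ((d + 1) ^ (2 * s)) s

/-- The algorithm for the simultaneous conjugacy problem. -/
noncomputable def conjAlgorithm (x : ℕ × List (AutomatonCode × AutomatonCode)) : Bool :=
  open Classical in decide (ConjTest x.1 (testLevel x.1 (totalSize x.2)) x.2)

/-- The finite test for the triviality of the `m`-th power on level `n`. -/
def PowTest (d n : ℕ) (c : AutomatonCode) (m : ℕ) : Prop :=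
  ∀ w ∈ wordsUpTo d n, (runCode c)^[m] w = w

/-- The bound for the finite orders of bounded automorphisms given by automata with `s` states. -/
def orderBound (d s : ℕ) : ℕ :=
  ((d + 1) ^ testLevel d (2 * s)).factorial

/-- The number of the first power that passes the triviality test, minus one. -/
noncomputable def firstTrivialPower (x : ℕ × AutomatonCode) : ℕ :=
  open Classical in (List.range (orderBound x.1 x.2.2.length)).findIdx fun i =>
    decide (PowTest x.1 (x.2.2.length ^ orderBound x.1 x.2.2.length) x.2 (i + 1))

/-- The algorithm for the order problem. -/
noncomputable def orderAlgorithm (x : ℕ × AutomatonCode) : ℕ :=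
  if firstTrivialPower x < orderBound x.1 x.2.2.length then firstTrivialPower x + 1 else 0

/-! ### Primitive recursiveness of the algorithms -/

section Primrec

open Primrec

variable {α β : Type*} [Primcodable α] [Primcodable β]

theorem PrimrecRel.forall_mem {R : β → α → Prop} (hR : PrimrecRel R) {f : α → List β}
    (hf : Primrec f) : PrimrecPred fun a => ∀ b ∈ f a, R b a :=
  hR.forall_mem_list.comp hf .id

theorem PrimrecRel.exists_mem {R : β → α → Prop} (hR : PrimrecRel R) {f : α → List β}
    (hf : Primrec f) : PrimrecPred fun a => ∃ b ∈ f a, R b a :=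
  hR.exists_mem_list.comp hf .id

theorem primrec_nat_pow : Primrec₂ ((· ^ ·) : ℕ → ℕ → ℕ) :=
  Primrec₂.unpaired'.1 Nat.Primrec.pow

theorem primrec_factorial : Primrec Nat.factorial := by
  refine (Primrec.nat_rec₁ (f := fun n m => (n + 1) * m) 1
    (nat_mul.comp (succ.comp fst) snd)).of_eq fun n => ?_
  induction n with
  | zero => rfl
  | succ n ih => rw [Nat.factorial_succ, ← ih]

theorem primrec_runCode : Primrec₂ runCode := by
  have hentry : Primrec fun x : (AutomatonCode × List ℕ) × ((ℕ × List ℕ) × ℕ) =>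
      (x.1.1.2.getD x.2.1.1 []).getD x.2.2 (0, 0) :=
    (list_getD _).comp ((list_getD _).comp (snd.comp (fst.comp fst)) (fst.comp (fst.comp snd)))
      (snd.comp snd)
  refine snd.comp (list_foldl (f := fun x : AutomatonCode × List ℕ => x.2)
    (g := fun x : AutomatonCode × List ℕ => (x.1.1, ([] : List ℕ)))
    (h := fun x y => (((x.1.2.getD y.1.1 []).getD y.2 (0, 0)).2,
      y.1.2 ++ [((x.1.2.getD y.1.1 []).getD y.2 (0, 0)).1]))
    snd ((fst.comp fst).pair (const [])) ?_)
  exact (snd.comp hentry).pair (list_concat.comp (snd.comp (fst.comp snd)) (fst.comp hentry))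

theorem primrec_tuples : Primrec₂ (tuples : List α → ℕ → List (List α)) := by
  refine Primrec.nat_rec (f := fun _ : List α => ([[]] : List (List α)))
    (g := fun L y => y.2.flatMap fun t => L.map fun x => x :: t) (const [[]]) ?_
  refine list_flatMap (snd.comp snd) ?_
  exact list_map (fst.comp fst) (list_cons.comp snd (snd.comp fst))

theorem primrec_wordsUpTo : Primrec₂ wordsUpTo :=
  list_flatMap (list_range.comp (succ.comp snd))
    (primrec_tuples.comp (list_range.comp (fst.comp fst)) snd)

theorem Primrec.tableLookup_comp {f g h : α → _} (hf : Primrec f) (hg : Primrec g)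
    (hh : Primrec h) : Primrec fun a => tableLookup (f a) (g a) (h a) :=
  ((list_getD _).comp hg (list_idxOf.comp hh hf)).of_eq fun a => by
    unfold tableLookup
    congr 2
    -- The two sides use different Boolean equality tests on words, which agree because both are
    -- lawful.
    exact lawful_beq_subsingleton _ _

/-- All quantifiers range over explicit lists. The prefix relation appears in the test as an
equality with `take`, and the equivalence as a disjunction, because these are assembled from
primitive recursive operations. -/
theorem primrecPred_conjTest :
    PrimrecPred fun x : (ℕ × ℕ) × List (AutomatonCode × AutomatonCode) =>
      ConjTest x.1.1 x.1.2 x.2 := by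
  have hws : Primrec fun x : (ℕ × ℕ) × List (AutomatonCode × AutomatonCode) =>
      wordsUpTo x.1.1 x.1.2 := primrec_wordsUpTo.comp (fst.comp fst) (snd.comp fst)
  refine PrimrecRel.exists_mem ?_ (primrec_tuples.comp hws (list_length.comp hws))
  have hT : PrimrecPred fun y : (List (List ℕ) × List (List ℕ)) ×
      List (AutomatonCode × AutomatonCode) => IsConjugatingTable y.1.1 y.1.2 y.2 := by
    refine .and ?_ (.and ?_ ?_)
    · refine PrimrecRel.forall_mem ?_ (fst.comp fst)
      exact Primrec.eq.comp (list_length.comp (.tableLookup_comp (fst.comp (fst.comp snd))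
        (snd.comp (fst.comp snd)) fst)) (list_length.comp fst)
    · refine PrimrecRel.forall_mem ?_ (fst.comp fst)
      refine PrimrecRel.forall_mem ?_ (fst.comp (fst.comp snd))
      have h1 := Primrec.tableLookup_comp (α := List ℕ × List ℕ × (List (List ℕ) ×
        List (List ℕ)) × List (AutomatonCode × AutomatonCode))
        (fst.comp (fst.comp (snd.comp snd))) (snd.comp (fst.comp (snd.comp snd))) fst
      have h2 := Primrec.tableLookup_comp (α := List ℕ × List ℕ × (List (List ℕ) ×
        List (List ℕ)) × List (AutomatonCode × AutomatonCode))
        (fst.comp (fst.comp (snd.comp snd))) (snd.comp (fst.comp (snd.comp snd))) (fst.comp snd)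
      have h3 := Primrec.eq.comp h2 (list_take.comp (list_length.comp h2) h1)
      have h4 := Primrec.eq.comp (α := List ℕ × List ℕ × (List (List ℕ) ×
        List (List ℕ)) × List (AutomatonCode × AutomatonCode)) (fst.comp snd)
        (list_take.comp (list_length.comp (fst.comp snd)) fst)
      exact .or (.and h3 h4) (.and h3.not h4.not)
    · refine PrimrecRel.forall_mem ?_ snd
      refine PrimrecRel.forall_mem ?_ (fst.comp (fst.comp snd))
      have h1 : Primrec fun z : List ℕ × (AutomatonCode × AutomatonCode) ×
          (List (List ℕ) × List (List ℕ)) × List (AutomatonCode × AutomatonCode) => z.2.2.1 :=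
        fst.comp (snd.comp snd)
      exact Primrec.eq.comp
        (primrec_runCode.comp (fst.comp (fst.comp snd))
          (.tableLookup_comp (fst.comp h1) (snd.comp h1) fst))
        (.tableLookup_comp (fst.comp h1) (snd.comp h1)
          (primrec_runCode.comp (snd.comp (fst.comp snd)) fst))
  exact hT.comp (((hws.comp snd).pair fst).pair (snd.comp snd))

theorem primrec_totalSize : Primrec totalSize := by
  refine list_foldr (f := fun L : List (AutomatonCode × AutomatonCode) => L) (g := fun _ => 0)
    (h := fun _ y => y.1.1.2.length + y.1.2.2.length + y.2) .id (const 0) ?_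
  exact nat_add.comp (nat_add.comp (list_length.comp (snd.comp (fst.comp (fst.comp snd))))
    (list_length.comp (snd.comp (snd.comp (fst.comp snd))))) (snd.comp snd)

theorem primrec_testLevel : Primrec₂ testLevel := by
  have hs : Primrec fun x : ℕ × ℕ => x.2 := snd
  have hc : Primrec fun x : ℕ × ℕ => (x.1 + 1) ^ (2 * x.2) :=
    primrec_nat_pow.comp (succ.comp fst) (nat_mul.comp (const 2) snd)
  have hb : Primrec fun x : ℕ × ℕ => 2 * (x.2 * (x.2 * x.2)) + 1 :=
    succ.comp (nat_mul.comp (const 2) (nat_mul.comp hs (nat_mul.comp hs hs)))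
  have he : Primrec fun x : ℕ × ℕ => 2 * (2 * x.2 * (x.1 + 1) ^ (2 * x.2)) + 1 :=
    succ.comp (nat_mul.comp (const 2) (nat_mul.comp (nat_mul.comp (const 2) hs) hc))
  exact primrec_nat_pow.comp (const 2) (primrec_nat_pow.comp hb he)

/-- The classical `decide` in the algorithm is harmless: the predicate it decides is primitive
recursive, and all decision instances agree. -/
theorem primrec_conjAlgorithm : Primrec conjAlgorithm := by
  classical
  have h := primrecPred_conjTest.comp
    (f := fun x : ℕ × List (AutomatonCode × AutomatonCode) =>
      ((x.1, testLevel x.1 (totalSize x.2)), x.2))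
    ((fst.pair (primrec_testLevel.comp fst (primrec_totalSize.comp snd))).pair snd)
  exact h.decide.of_eq fun x => by simp [conjAlgorithm]

theorem primrec_orderBound : Primrec₂ orderBound :=
  primrec_factorial.comp (primrec_nat_pow.comp (succ.comp fst)
    (primrec_testLevel.comp fst (nat_mul.comp (const 2) snd)))

theorem primrecPred_powTest :
    PrimrecPred fun x : (ℕ × ℕ) × AutomatonCode × ℕ => PowTest x.1.1 x.1.2 x.2.1 x.2.2 := by
  refine PrimrecRel.forall_mem ?_ (primrec_wordsUpTo.comp (fst.comp fst) (snd.comp fst))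
  refine Primrec.eq.comp (nat_iterate (snd.comp (snd.comp snd)) fst ?_) fst
  exact primrec_runCode.comp (fst.comp (snd.comp (snd.comp fst))) snd

theorem primrec_firstTrivialPower : Primrec firstTrivialPower := by
  classical
  have hS : Primrec fun x : ℕ × AutomatonCode => x.2.2.length :=
    list_length.comp (snd.comp snd)
  have hB : Primrec fun x : ℕ × AutomatonCode => orderBound x.1 x.2.2.length :=
    primrec_orderBound.comp fst hS
  refine list_findIdx (list_range.comp hB) ?_
  have h := primrecPred_powTest.comp
    (f := fun y : (ℕ × AutomatonCode) × ℕ =>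
      ((y.1.1, y.1.2.2.length ^ orderBound y.1.1 y.1.2.2.length), y.1.2, y.2 + 1))
    (((fst.comp fst).pair (primrec_nat_pow.comp (hS.comp fst) (hB.comp fst))).pair
      ((snd.comp fst).pair (succ.comp snd)))
  exact h.decide.of_eq fun x => by simp

theorem primrec_orderAlgorithm : Primrec orderAlgorithm := by
  have hB : Primrec fun x : ℕ × AutomatonCode => orderBound x.1 x.2.2.length :=
    primrec_orderBound.comp fst (list_length.comp (snd.comp snd))
  exact ite (nat_lt.comp primrec_firstTrivialPower hB) (succ.comp primrec_firstTrivialPower)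
    (const 0)

end Primrec

/-! ### Automata, their states and their codes -/

namespace InitAutomaton

variable {d : ℕ}

/-- The same automaton with another initial state. -/
def withInit (A : InitAutomaton d) (q : Fin A.size) : InitAutomaton d :=
  { A with init := q }

theorem withInit_run (A : InitAutomaton d) (p q : Fin A.size) (w : List (Fin d)) :
    (A.withInit p).run q w = A.run q w := by
  induction w generalizing q with
  | nil => rfl
  | cons x w ih => exact congrArg (A.out q x :: ·) (ih (A.next q x))

theorem run_append (A : InitAutomaton d) (q : Fin A.size) (v w : List (Fin d)) :
    A.run q (v ++ w) = A.run q v ++ A.run (v.foldl A.next q) w := by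
  induction v generalizing q with
  | nil => rfl
  | cons x v ih => simp only [List.cons_append, run, List.foldl_cons, ih]

/-- This bounds the number of states of the automorphism by the size of the automaton, a quantity
visible in the code. -/
theorem toAut_state (A : InitAutomaton d) (v : List (Fin d)) :
    A.toAut.state v = (A.withInit (v.foldl A.next A.init)).toAut :=
  TreeAut.eq_of_append_eq _ _ _ fun w =>
    (A.run_append A.init v w).trans (congrArg (A.run A.init v ++ ·) (A.withInit_run _ _ w).symm)

theorem range_state_subset (A : InitAutomaton d) :
    Set.range A.toAut.state ⊆ Set.range fun q => (A.withInit q).toAut := by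
  rintro _ ⟨v, rfl⟩
  exact ⟨_, (A.toAut_state v).symm⟩

theorem range_state_finite (A : InitAutomaton d) : (Set.range A.toAut.state).Finite :=
  (Set.finite_range _).subset A.range_state_subset

theorem ncard_range_state_le (A : InitAutomaton d) : (Set.range A.toAut.state).ncard ≤ A.size := by
  refine (Set.ncard_le_ncard A.range_state_subset (Set.finite_range _)).trans ?_
  rw [← Set.image_univ]
  refine (Set.ncard_image_le Set.finite_univ).trans ?_
  rw [Set.ncard_univ, Nat.card_eq_fintype_card, Fintype.card_fin]

theorem size_pos (A : InitAutomaton d) : 0 < A.size :=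
  Fin.pos A.init

theorem length_code (A : InitAutomaton d) : A.code.2.length = A.size := by
  simp [code]

/-- On the code of an automaton the default values of the table lookup are never reached. -/
theorem code_getD (A : InitAutomaton d) (q : Fin A.size) (x : Fin d) :
    (A.code.2.getD q []).getD x (0, 0) = ((A.out q x : ℕ), (A.next q x : ℕ)) := by
  simp [code, List.getD_eq_getElem?_getD]

theorem runCode_code (A : InitAutomaton d) (w : List (Fin d)) :
    runCode A.code (w.map Fin.val) = (A.toAut w).map Fin.val := by
  have key : ∀ (w : List (Fin d)) (q : Fin A.size) (o : List ℕ),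
      ((w.map Fin.val).foldl (fun st x =>
        (((A.code.2.getD st.1 []).getD x (0, 0)).2,
          st.2 ++ [((A.code.2.getD st.1 []).getD x (0, 0)).1])) ((q : ℕ), o)).2 =
      o ++ (A.run q w).map Fin.val := by
    intro w
    induction w with
    | nil => intro q o; simp [run]
    | cons x w ih =>
      intro q o
      rw [List.map_cons, List.foldl_cons, code_getD, ih]
      simp [run]
  exact key w A.init []

theorem iterate_runCode_code (A : InitAutomaton d) (m : ℕ) (w : List (Fin d)) :
    (runCode A.code)^[m] (w.map Fin.val) = ((A.toAut ^ m) w).map Fin.val := by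
  induction m with
  | zero => rfl
  | succ m ih =>
    rw [Function.iterate_succ_apply', ih, runCode_code, pow_succ', TreeAut.mul_apply]

end InitAutomaton

/-! ### Correctness of the algorithms -/

section Correctness

variable {d : ℕ}

theorem map_val_injective : Function.Injective (List.map (Fin.val : Fin d → ℕ)) :=
  List.map_injective_iff.2 Fin.val_injective

theorem mem_wordsUpTo {n : ℕ} {x : List ℕ} :
    x ∈ wordsUpTo d n ↔ ∃ w : List (Fin d), w.length ≤ n ∧ w.map Fin.val = x := by
  simp only [wordsUpTo, List.mem_flatMap, List.mem_range, mem_tuples]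
  constructor
  · rintro ⟨k, hk, rfl, hx⟩
    refine ⟨x.pmap (fun a h => ⟨a, h⟩) hx, by simpa using by omega, ?_⟩
    simp [List.map_pmap]
  · rintro ⟨w, hw, rfl⟩
    exact ⟨w.length, by omega, by simp, by simp⟩

theorem forall_mem_wordsUpTo {n : ℕ} {p : List ℕ → Prop} :
    (∀ x ∈ wordsUpTo d n, p x) ↔ ∀ w : List (Fin d), w.length ≤ n → p (w.map Fin.val) := by
  simp only [mem_wordsUpTo]
  exact ⟨fun h w hw => h _ ⟨w, hw, rfl⟩, by rintro h _ ⟨w, hw, rfl⟩; exact h w hw⟩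

theorem map_val_eq_take_iff (u w : List (Fin d)) :
    u.map Fin.val = (w.map Fin.val).take (u.map Fin.val).length ↔ u <+: w := by
  rw [List.length_map, ← List.map_take, map_val_injective.eq_iff, List.prefix_iff_eq_take]

/-- The pairs of automorphisms that a list of pairs of automata defines. -/
def autPairs (L : List (InitAutomaton d × InitAutomaton d)) : Set (TreeAut d × TreeAut d) :=
  {p | ∃ q ∈ L, (q.1.toAut, q.2.toAut) = p}

theorem isConjugatingTable_iff {n : ℕ} {L : List (InitAutomaton d × InitAutomaton d)}
    {hs : List (List ℕ)} {h : List (Fin d) → List (Fin d)}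
    (hh : ∀ w : List (Fin d), w.length ≤ n →
      tableLookup (wordsUpTo d n) hs (w.map Fin.val) = (h w).map Fin.val) :
    IsConjugatingTable (wordsUpTo d n) hs (L.map fun p => (p.1.code, p.2.code)) ↔
      TreeAut.IsLevelAut n h ∧
      ∀ p ∈ autPairs L, ∀ w, w.length ≤ n → p.1 (h w) = h (p.2 w) := by
  unfold IsConjugatingTable
  rw [← and_assoc]
  refine and_congr ?_ ?_
  · have h1 : (∀ w ∈ wordsUpTo d n, (tableLookup (wordsUpTo d n) hs w).length = w.length) ↔
        ∀ w : List (Fin d), w.length ≤ n → (h w).length = w.length := by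
      rw [forall_mem_wordsUpTo]
      refine forall_congr' fun w => forall_congr' fun hw => ?_
      rw [hh w hw, List.length_map, List.length_map]
    have h2 : (∀ u ∈ wordsUpTo d n, ∀ w ∈ wordsUpTo d n,
        (tableLookup (wordsUpTo d n) hs u = (tableLookup (wordsUpTo d n) hs w).take
          (tableLookup (wordsUpTo d n) hs u).length ∧ u = w.take u.length) ∨
        (¬ tableLookup (wordsUpTo d n) hs u = (tableLookup (wordsUpTo d n) hs w).take
          (tableLookup (wordsUpTo d n) hs u).length ∧ ¬ u = w.take u.length)) ↔
        ∀ u w : List (Fin d), u.length ≤ n → w.length ≤ n → (h u <+: h w ↔ u <+: w) := by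
      simp only [forall_mem_wordsUpTo]
      constructor
      · intro H u w hu hw
        have := H u hu w hw
        rw [hh u hu, hh w hw, map_val_eq_take_iff, map_val_eq_take_iff] at this
        tauto
      · intro H u hu w hw
        rw [hh u hu, hh w hw, map_val_eq_take_iff, map_val_eq_take_iff, H u w hu hw]
        tauto
    rw [h1, h2]
    exact ⟨fun H => ⟨H.1, H.2⟩, fun H => ⟨H.1, H.2⟩⟩
  · simp only [autPairs, Set.mem_ofPred_eq, List.mem_map, forall_exists_index, and_imp,
      forall_apply_eq_imp_iff₂, forall_mem_wordsUpTo]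
    refine forall_congr' fun p => forall_congr' fun _ => forall_congr' fun w =>
      forall_congr' fun hw => ?_
    rw [hh w hw, InitAutomaton.runCode_code, InitAutomaton.runCode_code,
      hh _ (by rwa [TreeAut.length_apply]), map_val_injective.eq_iff]

theorem conjTest_iff_levelConj {n : ℕ} {L : List (InitAutomaton d × InitAutomaton d)} :
    ConjTest d n (L.map fun p => (p.1.code, p.2.code)) ↔ TreeAut.LevelConj n (autPairs L) := by
  constructor
  · rintro ⟨hs, hmem, ht⟩
    rw [mem_tuples] at hmem
    -- Words outside the ball receive an arbitrary value; conjugacy on the ball does not see them.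
    have hex : ∀ w : List (Fin d), ∃ u : List (Fin d), w.length ≤ n →
        tableLookup (wordsUpTo d n) hs (w.map Fin.val) = u.map Fin.val := by
      intro w
      by_cases hw : w.length ≤ n
      · have h1 : w.map Fin.val ∈ wordsUpTo d n := mem_wordsUpTo.2 ⟨w, hw, rfl⟩
        have h2 : (wordsUpTo d n).idxOf (w.map Fin.val) < hs.length := by
          rw [hmem.1]
          exact List.idxOf_lt_length_iff.2 h1
        have h3 : tableLookup (wordsUpTo d n) hs (w.map Fin.val) ∈ wordsUpTo d n := by
          refine hmem.2 _ ?_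
          rw [tableLookup, List.getD_eq_getElem _ _ h2]
          exact List.getElem_mem h2
        obtain ⟨u, -, hu⟩ := mem_wordsUpTo.1 h3
        exact ⟨u, fun _ => hu.symm⟩
      · exact ⟨[], fun h => absurd h hw⟩
    choose h hh using hex
    exact ⟨h, (isConjugatingTable_iff hh).1 ht⟩
  · rintro ⟨h, hlev, hconj⟩
    have hdec : ∀ x : List ℕ, ∃ w : List (Fin d), x ∈ wordsUpTo d n →
        w.length ≤ n ∧ w.map Fin.val = x := by
      intro x
      by_cases hx : x ∈ wordsUpTo d n
      · obtain ⟨w, hw⟩ := mem_wordsUpTo.1 hx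
        exact ⟨w, fun _ => hw⟩
      · exact ⟨[], fun h => absurd h hx⟩
    choose dec hdec using hdec
    refine ⟨(wordsUpTo d n).map fun x => (h (dec x)).map Fin.val, ?_,
      (isConjugatingTable_iff (h := h) ?_).2 ⟨hlev, hconj⟩⟩
    · rw [mem_tuples]
      refine ⟨by simp, ?_⟩
      simp only [List.mem_map, forall_exists_index, and_imp, forall_apply_eq_imp_iff₂]
      intro x hx
      have h1 := hdec x hx
      exact mem_wordsUpTo.2 ⟨_, (hlev.length_eq _ h1.1).trans_le h1.1, rfl⟩
    · intro w hw
      have h1 : w.map Fin.val ∈ wordsUpTo d n := mem_wordsUpTo.2 ⟨w, hw, rfl⟩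
      have h2 := List.idxOf_lt_length_iff.2 h1
      rw [tableLookup, List.getD_eq_getElem _ _ (by simpa using h2), List.getElem_map,
        List.getElem_idxOf h2, map_val_injective (hdec _ h1).2]

theorem size_le_totalSize {L : List (InitAutomaton d × InitAutomaton d)}
    {p : InitAutomaton d × InitAutomaton d} (hp : p ∈ L) :
    p.1.size + p.2.size ≤ totalSize (L.map fun p => (p.1.code, p.2.code)) := by
  induction L with
  | nil => simp at hp
  | cons q L ih =>
    have h : totalSize ((q :: L).map fun p => (p.1.code, p.2.code)) =
        q.1.size + q.2.size + totalSize (L.map fun p => (p.1.code, p.2.code)) := by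
      simp [totalSize, InitAutomaton.length_code]
    rw [h]
    rcases List.mem_cons.1 hp with rfl | hp
    · omega
    · have := ih hp
      omega

/-- Every automaton has a state, namely its initial one. One number thus bounds both the number of
generators and their numbers of states. -/
theorem length_le_totalSize (L : List (InitAutomaton d × InitAutomaton d)) :
    L.length ≤ totalSize (L.map fun p => (p.1.code, p.2.code)) := by
  induction L with
  | nil => simp
  | cons q L ih =>
    have h : totalSize ((q :: L).map fun p => (p.1.code, p.2.code)) =
        q.1.size + q.2.size + totalSize (L.map fun p => (p.1.code, p.2.code)) := by
      simp [totalSize, InitAutomaton.length_code]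
    have := q.1.size_pos
    rw [h, List.length_cons]
    omega

theorem matchedDescendants_autPairs {L : List (InitAutomaton d × InitAutomaton d)}
    (hL : ∀ p ∈ L, p.1.toAut.IsBounded ∧ p.2.toAut.IsBounded) {s : ℕ} (hk : L.length ≤ s)
    (hs : ∀ p ∈ L, p.1.size + p.2.size ≤ s) :
    (TreeAut.matchedDescendants (Subgroup.closure (autPairs L))).Finite ∧
    (TreeAut.matchedDescendants (Subgroup.closure (autPairs L))).ncard ≤ testLevel d s := by
  classical
  let P : Finset (TreeAut d × TreeAut d) := (L.map fun q => (q.1.toAut, q.2.toAut)).toFinset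
  have hP : (P : Set (TreeAut d × TreeAut d)) = autPairs L := by
    ext p
    simp only [P, List.coe_toFinset, List.mem_map, Set.mem_ofPred_eq, autPairs]
  have hmem : ∀ p ∈ P, ∃ q ∈ L, (q.1.toAut, q.2.toAut) = p := fun p hp => by
    simpa [P] using hp
  rw [← hP]
  refine TreeAut.matchedDescendants_finite_and_ncard_le P ?_ ?_ ?_
  · refine (List.toFinset_card_le _).trans ?_
    rwa [List.length_map]
  · intro p hp m
    obtain ⟨q, hq, rfl⟩ := hmem p hp
    have h1 := hs q hq
    exact ⟨(hL q hq).1.ncard_state_ne_one_le (q.1.ncard_range_state_le.trans (by omega)) m,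
      (hL q hq).2.ncard_state_ne_one_le (q.2.ncard_range_state_le.trans (by omega)) m⟩
  · intro p hp
    obtain ⟨q, hq, rfl⟩ := hmem p hp
    have h1 := hs q hq
    exact ⟨q.1.range_state_finite, q.2.range_state_finite,
      q.1.ncard_range_state_le.trans (by omega), q.2.ncard_range_state_le.trans (by omega)⟩

theorem conjAlgorithm_eq_true_iff {L : List (InitAutomaton d × InitAutomaton d)}
    (hL : ∀ p ∈ L, p.1.toAut.IsBounded ∧ p.2.toAut.IsBounded) :
    conjAlgorithm (d, L.map fun p => (p.1.code, p.2.code)) = true ↔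
      ∃ h : TreeAut d, ∀ p ∈ L, h⁻¹ * p.1.toAut * h = p.2.toAut := by
  classical
  obtain ⟨hfin, hK⟩ := matchedDescendants_autPairs hL (length_le_totalSize L)
    fun p hp => size_le_totalSize hp
  rw [conjAlgorithm, decide_eq_true_iff, conjTest_iff_levelConj,
    ← TreeAut.exists_conj_iff_levelConj hfin hK]
  refine exists_congr fun h => ⟨fun H p hp => H _ ⟨p, hp, rfl⟩, ?_⟩
  rintro H _ ⟨p, hp, rfl⟩
  exact H p hp

theorem orderOf_toAut_le {A : InitAutomaton d} (hA : A.toAut.IsBounded) :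
    orderOf A.toAut ≤ orderBound d A.size := by
  have h := matchedDescendants_autPairs (L := [(A, A)]) (s := 2 * A.size) (by simpa using hA)
    (by have := A.size_pos; simp; omega) (by simp; omega)
  have h1 : autPairs [(A, A)] = {(A.toAut, A.toAut)} := by
    ext p
    simp [autPairs, eq_comm]
  rw [h1] at h
  exact TreeAut.orderOf_le h.1 h.2

/-- A finite order is at most `M`, so the search through the exponents `1, …, M` finds it or shows
that the order is infinite, encoded as `0` as in `orderOf`. The radius `A.size ^ M` serves all these
exponents, since the `m`-th power has at most `A.size ^ m` states. -/
theorem orderAlgorithm_eq {A : InitAutomaton d} (hA : A.toAut.IsBounded) :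
    orderAlgorithm (d, A.code) = orderOf A.toAut := by
  classical
  have hle := orderOf_toAut_le hA
  set M := orderBound d A.size with hM
  have htest : ∀ m ≤ M, PowTest d (A.size ^ M) A.code m ↔ A.toAut ^ m = 1 := by
    intro m hm
    rw [A.toAut.pow_eq_one_iff_of_ncard_le A.range_state_finite A.ncard_range_state_le
      (Nat.pow_le_pow_right A.size_pos hm), PowTest, forall_mem_wordsUpTo]
    refine forall_congr' fun w => forall_congr' fun _ => ?_
    rw [A.iterate_runCode_code, map_val_injective.eq_iff]
  have hfirst : firstTrivialPower (d, A.code) = (List.range M).findIdx fun i =>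
      decide (PowTest d (A.size ^ M) A.code (i + 1)) := by
    simp only [firstTrivialPower, A.length_code, hM]
  have halg : orderAlgorithm (d, A.code) = if firstTrivialPower (d, A.code) < M then
      firstTrivialPower (d, A.code) + 1 else 0 := by
    simp only [orderAlgorithm, A.length_code, hM]
  rw [halg]
  set i := firstTrivialPower (d, A.code) with hi
  have hbefore : ∀ j < i, j < M → A.toAut ^ (j + 1) ≠ 1 := by
    intro j hj hjM h
    rw [hfirst] at hj
    have h1 := List.not_of_lt_findIdx hj
    simp only [List.getElem_range] at h1
    exact absurd ((htest (j + 1) hjM).2 h) (by simpa using h1)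
  have hpos : orderOf A.toAut ≠ 0 → i ≤ orderOf A.toAut - 1 := by
    -- The search index `i` stands for the exponent `i + 1`, hence the shift by one.
    intro h0
    by_contra! h
    refine hbefore _ h (by omega) ?_
    rw [Nat.sub_add_cancel (by omega), pow_orderOf_eq_one]
  split_ifs with hlt
  · have h1 : A.toAut ^ (i + 1) = 1 := by
      rw [← htest (i + 1) hlt]
      have h2 : (List.range M).findIdx (fun i =>
          decide (PowTest d (A.size ^ M) A.code (i + 1))) < (List.range M).length := by
        rw [← hfirst, List.length_range]
        exact hlt
      have h3 := List.findIdx_getElem (w := h2)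
      simp only [List.getElem_range, decide_eq_true_eq] at h3
      rwa [← hfirst] at h3
    have h2 := orderOf_dvd_of_pow_eq_one h1
    have h3 := Nat.le_of_dvd (Nat.succ_pos i) h2
    have h4 : orderOf A.toAut ≠ 0 := fun h => by
      rw [h, zero_dvd_iff] at h2
      omega
    have := hpos h4
    omega
  · by_contra h0
    have := hpos (Ne.symm h0)
    omega

end Correctness

theorem mainTheorem5 :
    (∃ f : ℕ × (ℕ × List (List (ℕ × ℕ))) →. ℕ, Partrec f ∧
      ∀ (d : ℕ) (A : InitAutomaton d), A.toAut.IsBounded →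
        orderOf A.toAut ∈ f (d, A.code)) ∧
    (∃ f : ℕ × (ℕ × List (List (ℕ × ℕ))) × (ℕ × List (List (ℕ × ℕ))) →. Bool, Partrec f ∧
      ∀ (d : ℕ) (A B : InitAutomaton d), A.toAut.IsBounded → B.toAut.IsBounded →
        ∃ r ∈ f (d, A.code, B.code),
          (r = true ↔ ∃ h : TreeAut d, h⁻¹ * A.toAut * h = B.toAut)) ∧
    (∃ f : ℕ × List ((ℕ × List (List (ℕ × ℕ))) × (ℕ × List (List (ℕ × ℕ)))) →. Bool, Partrec f ∧
      ∀ (d : ℕ) (L : List (InitAutomaton d × InitAutomaton d)),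
        (∀ p ∈ L, p.1.toAut.IsBounded ∧ p.2.toAut.IsBounded) →
        ∃ r ∈ f (d, L.map fun p => (p.1.code, p.2.code)),
          (r = true ↔ ∃ h : TreeAut d, ∀ p ∈ L, h⁻¹ * p.1.toAut * h = p.2.toAut)) := by
  refine ⟨⟨fun x => Part.some (orderAlgorithm x), primrec_orderAlgorithm.to_comp.partrec,
    fun d A hA => Part.mem_some_iff.2 (orderAlgorithm_eq hA).symm⟩,
    -- Conjugacy of two automorphisms is the simultaneous problem for a list with one pair.
    ⟨fun x => Part.some (conjAlgorithm (x.1, [x.2])), ?_, fun d A B hA hB =>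
      ⟨_, Part.mem_some _, ?_⟩⟩,
    ⟨fun x => Part.some (conjAlgorithm x), primrec_conjAlgorithm.to_comp.partrec, fun d L hL =>
      ⟨_, Part.mem_some _, conjAlgorithm_eq_true_iff hL⟩⟩⟩
  · exact (primrec_conjAlgorithm.comp (Primrec.fst.pair
      (Primrec.list_cons.comp Primrec.snd (Primrec.const [])))).to_comp.partrec
  · have h := conjAlgorithm_eq_true_iff (L := [(A, B)]) (by simpa using ⟨hA, hB⟩)
    simpa using h
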